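/- **Definitions.** Let $n\ge 1$. *Signed permutations.* A signed permutation of $[n]=\{1,\dots,n\}$ is a word $\sigma=\sigma_1\cdots\sigma_n$ of nonzero integers such that $|\sigma_1|,\dots,|\sigma_n|$ is a permutation of $1,\dots,n$. For $1\le |k|\le n$: - $\mathcal S_{n,k}$ is the set of signed permutations of $[n]$ with $\sigma_1>\sigma_2<\sigma_3>\sigma_4<\cdots$ and $\sigma_1=k$ (type $B$ alternating permutations; snakes if $k>0$). - $\mathcal A^{(B)}_{n,k}$ is the set of signed permutations $\sigma$ of $[n]$ with $\sigma_n=k$ such that for every $1\le j\le n$ the subword $\sigma_{[j]}$ of the $j$ smallest entries (in their order of appearance in $\sigma$) has no three consecutive letters $a>b>c$ and, if $j\ge2$, ends with an ascent (signed André permutations). *Trees.* An increasing 1-2 tree on a finite set $V$ of integers is a rooted tree with vertex set $V$ in which every vertex has at most two children and is smaller than each of its children. An only child is called a left child; of two siblings the smaller one is the left child and the larger one the right child. The minimal leaf is the end of the path that starts at the root and always passes to the left child until it reaches a leaf. $\mathcal T^{(B)}_{n,k}$ is the set of increasing 1-2 trees with minimal leaf $k$ on the sets $V$ of $n$ nonzero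 integers whose absolute values are $1,\dots,n$ (type $B$ increasing 1-2 trees). *Arnold numbers.* For $1\le|k|\le n$ let $S_{1,1}=S_{1,-1}=1$, $S_{n,-n}=0$ for $n\ge2$, and $$S_{n,k}=\begin{cases}S_{n,k-1}+S_{n-1,-k+1}&\text{if } n\ge k>1,\\ S_{n,-1}&\text{if } n>k=1,\\ S_{n,k-1}+S_{n-1,-k}&\text{if } -1\ge k>-n.\end{cases}$$ A family of sets $(X_{n,k})_{1\le|k|\le n}$ is an Arnold family if $\#X_{n,k}=S_{n,k}$ for all $1\le|k|\le n$. *The map $\psi$.* It sends permutations $\pi$ of $[n]$ with $\pi_1>\pi_2<\pi_3>\cdots$ to increasing 1-2 trees on $[n]$ and is defined recursively. For $n=1,2$ there is one such permutation and one such tree. Let $n\ge3$ and $k=\pi_1$. 1. If $\pi_2=k-1$: delete $k$ and $k-1$ from $\pi$, relabel by $[n-2]$ preserving the order, apply $\psi$, and relabel the resulting tree by $[n]\setminus\{k-1,k\}$ preserving the order. Let $m$ be the smallest vertex greater than $k$ on the minimal path. Insert $k-1$ on the edge from the parent of $m$ to $m$ (as new root if $m$ is the root) and attach $k$ as the left child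 of $k-1$ (so $m$ is its right child). 2. If $\pi_2<k-1$: let $T'=\psi(\pi')$, where $\pi'$ is obtained from $\pi$ by exchanging $k-1$ and $k$. If $k-1$ and $k$ are not siblings in $T'$, then $\psi(\pi)$ is $T'$ with the labels $k-1$ and $k$ exchanged. If they are siblings, with parent $\ell$, and $A$ and $B$ are the (possibly empty) left and right subtrees above $k$, then $\psi(\pi)$ is obtained by replacing the part above $\ell$ as follows: the left child of $\ell$ is $k-1$ and the right subtree of $\ell$ is $A$; the left child of $k-1$ is the leaf $k$ and the right subtree of $k-1$ is $B$. *The map $\omega$.* It sends an increasing 1-2 tree on $[n]$ to the word of its vertices read in reverse inorder (right subtree, vertex, left subtree, recursively). *Relabeling.* For a set $V$ of $n$ integers let $\pi_V:V\to[n]$ be the order-preserving bijection. With $V$ the set of entries of $\sigma$, respectively the set of labels of $T$, put $$\psi^B(\sigma)=\pi_V^{-1}\bigl(\psi(\pi_V(\sigma))\bigr),\qquad \omega^B(T)=\pi_V^{-1}\bigl(\omega(\pi_V(T))\bigr),$$ where maps act on words and trees letter by letter and label by label. **Theorem 2.6.** For all $n$ and $k$ with $1\le|k|\le n$, the maps $\psi^B$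 and $\omega^B$ restrict to bijections $$\psi^B:\mathcal S_{n,k}\to\mathcal T^{(B)}_{n,k},\qquad \omega^B:\mathcal T^{(B)}_{n,k}\to\mathcal A^{(B)}_{n,k}.$$ Consequently, for all $1\le|k|\le n$, $$S_{n,k}=\#\mathcal A^{(B)}_{n,k}=\#\mathcal T^{(B)}_{n,k},$$ that is, $(\mathcal A^{(B)}_{n,k})$ and $(\mathcal T^{(B)}_{n,k})$ are Arnold families. -/

import Mathlib

namespace ArnoldFamily

/-- Root label of a binary tree (`none` for the empty tree). -/
def rootLabel {α : Type*} : BinaryTree α → Option α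
  | .nil => none
  | .node v _ _ => some v

/-- The word of the labels of a binary tree read in inorder:
left subtree, then the vertex, then right subtree. -/
def inorder {α : Type*} : BinaryTree α → List α
  | .nil => []
  | .node v l r => inorder l ++ v :: inorder r

/-- `minLeaf T` is the last vertex of the minimal path of `T`, the path that starts at the root and
goes to the left child as long as there is one (`none` for the empty tree). -/
def minLeaf {α : Type*} : BinaryTree α → Option α
  | .nil => none
  | .node v l _ => some ((minLeaf l).getD v)

/-- Increasing 1-2 trees. Such a tree is a rooted tree without plane structure whose vertices have at
most two children, with distinct labels that increase along edges away from the root. It is stored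
in its unique drawing in which an only child is a left child, and of two siblings the smaller one is
the left child. Thus every vertex is smaller than its children, and the root of a non-empty right
subtree is larger than the root of the (non-empty) left subtree beside it. -/
def IsIncreasing {α : Type*} [LT α] : BinaryTree α → Prop
  | .nil => True
  | .node v l r =>
      (∀ x ∈ rootLabel l, v < x) ∧ (∀ y ∈ rootLabel r, v < y) ∧
      (∀ y ∈ rootLabel r, ∃ x ∈ rootLabel l, x < y) ∧
      IsIncreasing l ∧ IsIncreasing r

/-- A word `w` is (the list of entries of) a signed permutation of `[n]`: the absolute values of its
entries form a permutation of `1, …, n`. -/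
def IsSignedPerm (n : ℕ) (w : List ℤ) : Prop :=
  (w.map Int.natAbs).Perm (List.range' 1 n)

/-- Down-up alternating words: `w₁ > w₂ < w₃ > w₄ < ⋯`. -/
def IsDownUp {α : Type*} [LT α] : List α → Prop
  | a :: b :: c :: w => b < a ∧ b < c ∧ IsDownUp (c :: w)
  | [a, b] => b < a
  | _ => True

/-- The subword of `w` consisting of its `j` smallest entries, in the order in which they appear
(for words with distinct entries). -/
def smallest (w : List ℤ) (j : ℕ) : List ℤ :=
  w.filter fun x => (w.filter fun y => y ≤ x).length ≤ j

/-- No three consecutive letters `a > b > c`. -/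
def NoDoubleDescent (w : List ℤ) : Prop :=
  ∀ a b c : ℤ, [a, b, c] <:+: w → ¬ (b < a ∧ c < b)

/-- The last two letters form an ascent (no condition on words with fewer than two letters). -/
def EndsWithAscent (w : List ℤ) : Prop :=
  ∀ a b : ℤ, [a, b] <:+ w → a < b

/-- Type B alternating permutations of `[n]` with first entry `k` (for `k > 0`: the snakes). -/
def snakesB (n : ℕ) (k : ℤ) : Set (List ℤ) :=
  {w | IsSignedPerm n w ∧ IsDownUp w ∧ w.head? = some k}

/-- Type B increasing 1-2 trees on `[n]` with minimal leaf `k`. -/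
def treesB (n : ℕ) (k : ℤ) : Set (BinaryTree ℤ) :=
  {T | IsIncreasing T ∧ IsSignedPerm n (inorder T) ∧ minLeaf T = some k}

/-- Signed André permutations of `[n]` with last entry `k`. -/
def andreB (n : ℕ) (k : ℤ) : Set (List ℤ) :=
  {w | IsSignedPerm n w ∧
    (∀ j, 1 ≤ j → j ≤ n → NoDoubleDescent (smallest w j) ∧ EndsWithAscent (smallest w j)) ∧
    w.getLast? = some k}

/-- The Arnold numbers `S_{n,k}`, `1 ≤ |k| ≤ n` (and `0` outside of this range). -/
def arnold (n : ℕ) (k : ℤ) : ℕ :=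
  if k = 0 ∨ (n : ℤ) < |k| then 0
  else if n = 1 then 1
  else if k = -(n : ℤ) then 0
  else if k < 0 then arnold n (k - 1) + arnold (n - 1) (-k)
  else if k = 1 then arnold n (-1)
  else arnold n (k - 1) + arnold (n - 1) (-k + 1)
termination_by (n, (k + n).toNat)
decreasing_by
  all_goals
    simp only [not_or, not_lt, abs_le] at *
    first
      | exact Prod.Lex.left _ _ (by omega)
      | exact Prod.Lex.right _ (by omega)

/-- `(X_{n,k})` is an Arnold family if `X_{n,k}` has exactly `S_{n,k}` elements
for `1 ≤ |k| ≤ n`. -/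
def IsArnoldFamily {α : Type*} (X : ℕ → ℤ → Set α) : Prop :=
  ∀ (n : ℕ) (k : ℤ), 1 ≤ |k| → |k| ≤ (n : ℤ) → (X n k).encard = arnold n k

/-- Let `m` be the smallest vertex greater than `k` on the minimal path of `T`. Put a new
vertex `k - 1` on the edge from the parent of `m` to `m` (above the root if `m` is the root),
with left child a new leaf `k` and right child `m`. -/
def graft (k : ℕ) : BinaryTree ℕ → BinaryTree ℕ
  | .nil => .nil
  | .node v l r =>
      if k < v then .node (k - 1) (.node k .nil .nil) (.node v l r)
      else .node v (graft k l) r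

/-- Some vertex of the tree has left child `a` and right child `b`. -/
def areSiblings (a b : ℕ) : BinaryTree ℕ → Bool
  | .nil => false
  | .node _ l r =>
      (rootLabel l == some a && rootLabel r == some b) || areSiblings a b l || areSiblings a b r

/-- At the vertex `v` of the minimal path whose left child is the leaf `k - 1` and whose right child
is `k`, with left and right subtrees `A` and `B` above `k`: make `A` the right subtree of `v`, and
give its left child `k - 1` the leaf `k` as left child and `B` as right subtree. -/
def rotate (k : ℕ) : BinaryTree ℕ → BinaryTree ℕ
  | .nil => .nil
  | .node v l r =>
      if rootLabel l = some (k - 1) ∧ rootLabel r = some k then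
        .node v (.node (k - 1) (.node k .nil .nil) r.right) r.left
      else .node v (rotate k l) r

/-- The bijection `ψ` of Gelineau, Shin and Zeng from down-up alternating permutations of `[n]` to
increasing 1-2 trees on `[n]`, for a permutation with first entries `k, j`.
If `j = k - 1`: remove `k` and `k - 1`, standardize, apply `ψ`, make room for the labels `k - 1` and
`k`, and graft these. If `j < k - 1`: exchange `k - 1` and `k`, apply `ψ`, and then rotate if
`k - 1` and `k` are siblings, and exchange the labels `k - 1` and `k` otherwise.
(Words that are not down-up get irrelevant values.) -/
def psi : List ℕ → BinaryTree ℕ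
  | [] => .nil
  | [a] => .node a .nil .nil
  | [a, b] => .node b (.node a .nil .nil) .nil
  | k :: j :: c :: w =>
      if j + 1 = k then
        graft k ((psi ((c :: w).map fun x => if k < x then x - 2 else x)).map
          fun x => if x + 1 < k then x else x + 2)
      else if j + 1 < k then
        let T := psi ((k :: j :: c :: w).map (Equiv.swap (k - 1) k))
        if areSiblings (k - 1) k T then rotate k T else T.map (Equiv.swap (k - 1) k)
      else .nil
termination_by w => (w.length, w.headD 0)
decreasing_by
  all_goals simp [Prod.lex_def]
  all_goals omega

/-- The map `ω`: read the vertices of the tree in reverse inorder. -/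
def omega (T : BinaryTree ℕ) : List ℕ := (inorder T).reverse

/-- The order-preserving map `V → {1, …, |V|}`, sending the `i`-th smallest element to `i`. -/
def rank (V : Finset ℤ) (x : ℤ) : ℕ := (V.filter (· ≤ x)).card

/-- The inverse of `rank V`: the `i`-th smallest element of `V`, for `1 ≤ i ≤ |V|`. -/
def unrank (V : Finset ℤ) (i : ℕ) : ℤ := (V.sort (· ≤ ·)).getD (i - 1) 0

/-- `ψ^B(σ) = π⁻¹(ψ(π σ))`, where `π` is the order-preserving map from the entries of `σ`
to `[n]`. -/
def psiB (w : List ℤ) : BinaryTree ℤ :=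
  (psi (w.map (rank w.toFinset))).map (unrank w.toFinset)

/-- `ω^B(T) = π⁻¹(ω(π T))`, where `π` is the order-preserving map from the labels of `T`
to `[n]`. -/
def omegaB (T : BinaryTree ℤ) : List ℤ :=
  (omega (T.map (rank (inorder T).toFinset))).map (unrank (inorder T).toFinset)

end ArnoldFamily

open ArnoldFamily

/-! Three facts carry the theorem: `omegaB` and `psiB` are bijections, and the sets `snakesB n k`
satisfy the Arnold recurrence. The counts for trees and André words then follow by transport.

For `omegaB`, relabelling cancels and only reverse inorder remains. The minimum of a word plays the
role of the root and cuts the word into (right subtree, root, left subtree). The André condition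
says exactly that both factors are André and that the right root exceeds the left root: a final
descent in a truncated left factor of the word would become a double descent at the minimum, and a
right subtree holding labels up to t while the left one holds none would give a final descent
(`IsIncreasing.isAndre`, `IsAndre.exists_tree`, `IsIncreasing.eq_of_inorder_eq`).

For `psi` on labels 1, …, n (`psi_bijOn`), write the first entry as a + 1 and induct on n, then on
a. Words with second entry a lose two letters; the other words become words with first entry a under
exchange of a and a + 1. The trees with minimal leaf a + 1 split in parallel. If a is the parent of
that leaf and can be replaced by its right child, the tree comes from a unique graft
(`bijOn_graft`). If a is the parent but cannot be replaced, it comes from a rotation; if a is not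
the parent, from a label exchange (`bijOn_rotateOrSwap`). Explicit inverses show that these cases
are disjoint and exhaust all trees. The signed version `psiB_bijOn` follows because `psiB` preserves
the set of labels, so that ranks can be undone.

For the recurrence (`encard_snakesB`), split snakes with first entry k by whether the second entry
is k - 1. If not, exchanging k with k - 1, and likewise their negatives, lowers the first entry. If
so, delete k, negate the rest, which is then down-up again, and close the gap in absolute values. At
k = 1 the value k - 1 = 0 is unavailable, and exchanging 1 and -1 replaces this step. -/

namespace ArnoldFamily

/-! ### Binary trees: inorder words, minimal leaves, relabelling -/

section Trees

variable {α β : Type*}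

theorem inorder_map (f : α → β) (T : BinaryTree α) :
    inorder (T.map f) = (inorder T).map f := by
  induction T with
  | nil => rfl
  | node v l r hl hr => simp [inorder, BinaryTree.map, hl, hr]

theorem rootLabel_map (f : α → β) (T : BinaryTree α) :
    rootLabel (T.map f) = (rootLabel T).map f := by
  cases T <;> rfl

theorem minLeaf_map (f : α → β) (T : BinaryTree α) :
    minLeaf (T.map f) = (minLeaf T).map f := by
  induction T with
  | nil => rfl
  | node v l r hl hr => cases h : minLeaf l <;> simp [minLeaf, BinaryTree.map, hl, h]

/-- Both sides follow left children to the end. This is why reverse inorder turns the minimal leaf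
into the last letter. -/
theorem head?_inorder (T : BinaryTree α) : (inorder T).head? = minLeaf T := by
  induction T with
  | nil => rfl
  | node v l r hl hr =>
    simp only [inorder, List.head?_append, hl, minLeaf]
    cases minLeaf l <;> rfl

theorem mem_inorder_of_minLeaf {T : BinaryTree α} {x : α} (h : minLeaf T = some x) :
    x ∈ inorder T :=
  List.mem_of_head? ((head?_inorder T).trans h)

theorem mem_inorder_of_rootLabel {T : BinaryTree α} {x : α} (h : rootLabel T = some x) :
    x ∈ inorder T := by
  cases T <;> simp_all [rootLabel, inorder]

theorem minLeaf_node_of_some {v x : α} {l r : BinaryTree α} (h : minLeaf l = some x) :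
    minLeaf (.node v l r) = some x := by
  simp [minLeaf, h]

theorem minLeaf_eq_none {T : BinaryTree α} : minLeaf T = none ↔ T = .nil := by
  cases T <;> simp [minLeaf]

theorem rootLabel_eq_none {T : BinaryTree α} : rootLabel T = none ↔ T = .nil := by
  cases T <;> simp [rootLabel]

theorem minLeaf_node {v x : α} {l r : BinaryTree α} (h : minLeaf (.node v l r) = some x) :
    minLeaf l = some x ∨ l = .nil ∧ v = x := by
  cases hl : minLeaf l with
  | none => simp_all [minLeaf, minLeaf_eq_none.1 hl]
  | some y => simp_all [minLeaf]

theorem IsIncreasing.rootLabel_le [Preorder α] {T : BinaryTree α} (hT : IsIncreasing T) {a : α}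
    (ha : rootLabel T = some a) : ∀ x ∈ inorder T, a ≤ x := by
  induction T generalizing a with
  | nil => simp [inorder]
  | node v l r hl hr =>
    obtain ⟨h1, h2, -, h4, h5⟩ := hT
    simp only [rootLabel, Option.some.injEq] at ha
    subst ha
    intro x hx
    simp only [inorder, List.mem_append, List.mem_cons] at hx
    rcases hx with hx | rfl | hx
    · cases h : rootLabel l with
      | none => simp [rootLabel_eq_none.1 h, inorder] at hx
      | some y => exact (h1 y h).le.trans (hl h4 h x hx)
    · exact le_rfl
    · cases h : rootLabel r with
      | none => simp [rootLabel_eq_none.1 h, inorder] at hx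
      | some y => exact (h2 y h).le.trans (hr h5 h x hx)

theorem IsIncreasing.lt_of_mem_left [Preorder α] {v : α} {l r : BinaryTree α}
    (hT : IsIncreasing (.node v l r)) {x : α} (hx : x ∈ inorder l) : v < x := by
  cases h : rootLabel l with
  | none => simp [rootLabel_eq_none.1 h, inorder] at hx
  | some y => exact (hT.1 y h).trans_le (hT.2.2.2.1.rootLabel_le h x hx)

theorem IsIncreasing.lt_of_mem_right [Preorder α] {v : α} {l r : BinaryTree α}
    (hT : IsIncreasing (.node v l r)) {x : α} (hx : x ∈ inorder r) : v < x := by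
  cases h : rootLabel r with
  | none => simp [rootLabel_eq_none.1 h, inorder] at hx
  | some y => exact (hT.2.1 y h).trans_le (hT.2.2.2.2.rootLabel_le h x hx)

theorem IsIncreasing.map [LT α] [LT β] {f : α → β} {T : BinaryTree α} (hT : IsIncreasing T)
    (hf : ∀ x ∈ inorder T, ∀ y ∈ inorder T, x < y → f x < f y) : IsIncreasing (T.map f) := by
  induction T with
  | nil => trivial
  | node v l r hl hr =>
    obtain ⟨h1, h2, h3, h4, h5⟩ := hT
    simp only [inorder, List.mem_append, List.mem_cons] at hf
    refine ⟨?_, ?_, ?_, hl h4 fun x hx y hy => hf x (.inl hx) y (.inl hy),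
      hr h5 fun x hx y hy => hf x (.inr (.inr hx)) y (.inr (.inr hy))⟩
    · simp only [rootLabel_map, Option.mem_def, Option.map_eq_some_iff]
      rintro _ ⟨x, hx, rfl⟩
      exact hf _ (.inr (.inl rfl)) _ (.inl (mem_inorder_of_rootLabel hx)) (h1 x hx)
    · simp only [rootLabel_map, Option.mem_def, Option.map_eq_some_iff]
      rintro _ ⟨x, hx, rfl⟩
      exact hf _ (.inr (.inl rfl)) _ (.inr (.inr (mem_inorder_of_rootLabel hx))) (h2 x hx)
    · simp only [rootLabel_map, Option.mem_def, Option.map_eq_some_iff]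
      rintro _ ⟨y, hy, rfl⟩
      obtain ⟨x, hx, hxy⟩ := h3 y hy
      exact ⟨_, ⟨x, hx, rfl⟩, hf _ (.inl (mem_inorder_of_rootLabel hx)) _
        (.inr (.inr (mem_inorder_of_rootLabel hy))) hxy⟩

theorem map_congr {f g : α → β} {T : BinaryTree α} (h : ∀ x ∈ inorder T, f x = g x) :
    T.map f = T.map g := by
  induction T with
  | nil => rfl
  | node v l r hl hr =>
    simp only [inorder, List.mem_append, List.mem_cons] at h
    simp only [BinaryTree.map]
    rw [h v (by simp), hl fun x hx => h x (by simp [hx]), hr fun x hx => h x (by simp [hx])]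

theorem map_map_eq_self {f : α → β} {g : β → α} {T : BinaryTree α}
    (h : ∀ x ∈ inorder T, g (f x) = x) : (T.map f).map g = T := by
  rw [← BinaryTree.comp_map]
  exact (map_congr (g := id) h).trans T.id_map

theorem list_map_map_eq_self {f : α → β} {g : β → α} {w : List α}
    (h : ∀ x ∈ w, g (f x) = x) : (w.map f).map g = w := by
  rw [List.map_map]
  exact (List.map_congr_left h).trans (List.map_id w)

end Trees

/-! ### André words and reverse inorder -/

section ReverseInorder

/-- The André condition, with the smallest entries selected by a threshold. -/
def IsAndre (w : List ℤ) : Prop :=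
  ∀ t : ℤ, NoDoubleDescent (w.filter (· ≤ t)) ∧ EndsWithAscent (w.filter (· ≤ t))

theorem noDoubleDescent_nil : NoDoubleDescent [] := fun a b c h => by simp at h

theorem endsWithAscent_nil : EndsWithAscent [] := fun a b h => by simp at h

theorem length_filter_le_mono (w : List ℤ) {s t : ℤ} (h : s ≤ t) :
    (w.filter (· ≤ s)).length ≤ (w.filter (· ≤ t)).length := by
  simp only [← List.countP_eq_length_filter]
  exact List.countP_mono_left fun x _ hx => by simp_all; omega

theorem length_filter_le_strict {w : List ℤ} {t x : ℤ} (hx : x ∈ w) (h : t < x) :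
    (w.filter (· ≤ t)).length < (w.filter (· ≤ x)).length := by
  induction w with
  | nil => simp at hx
  | cons a w ih =>
    have := length_filter_le_mono w h.le
    rcases List.mem_cons.1 hx with rfl | hx
    · rw [List.filter_cons_of_neg (by simpa using h), List.filter_cons_of_pos (by simp)]
      simp only [List.length_cons]; omega
    · specialize ih hx
      by_cases h1 : a ≤ t
      · rw [List.filter_cons_of_pos (by simpa using h1),
          List.filter_cons_of_pos (by simpa using h1.trans h.le)]
        simpa using ih
      · rw [List.filter_cons_of_neg (by simpa using h1)]
        exact ih.trans_le ((List.Sublist.filter _ (List.sublist_cons_self a w)).length_le)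

/-- A nonempty `smallest w j` consists of all letters up to its maximum t; conversely, the letters
up to t are `smallest w j` for j their number. Thresholds, unlike counts, pass unchanged to the
factors of a word, which makes induction on trees possible. -/
theorem isAndre_iff_smallest (w : List ℤ) : IsAndre w ↔ ∀ j, 1 ≤ j → j ≤ w.length →
    NoDoubleDescent (smallest w j) ∧ EndsWithAscent (smallest w j) := by
  constructor
  · intro h j _ _
    by_cases h0 : smallest w j = []
    · rw [h0]; exact ⟨noDoubleDescent_nil, endsWithAscent_nil⟩
    obtain ⟨t, ht, htmax⟩ := (smallest w j).toFinset.exists_max_image id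
      (by simpa [List.toFinset_nonempty_iff] using h0)
    have hsm : smallest w j = w.filter (· ≤ t) := by
      refine List.filter_congr fun x hx => ?_
      simp only [smallest, List.mem_toFinset, List.mem_filter, decide_eq_true_eq, id] at ht htmax
      simp only [decide_eq_decide]
      exact ⟨fun hj => htmax x ⟨hx, hj⟩, fun hxt => (length_filter_le_mono w hxt).trans ht.2⟩
    rw [hsm]; exact h t
  · intro h t
    by_cases h0 : w.filter (· ≤ t) = []
    · rw [h0]; exact ⟨noDoubleDescent_nil, endsWithAscent_nil⟩
    have hsm : smallest w (w.filter (· ≤ t)).length = w.filter (· ≤ t) := by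
      refine List.filter_congr fun x hx => ?_
      simp only [decide_eq_decide]
      refine ⟨fun hj => ?_, length_filter_le_mono w⟩
      by_contra hxt
      exact absurd (length_filter_le_strict hx (not_le.1 hxt)) (by omega)
    rw [← hsm]
    exact h _ (List.length_pos_iff.2 h0) (List.length_filter_le _ _)

theorem NoDoubleDescent.infix {u w : List ℤ} (hw : NoDoubleDescent w) (h : u <:+: w) :
    NoDoubleDescent u :=
  fun a b c h' => hw a b c (h'.trans h)

theorem EndsWithAscent.suffix {u w : List ℤ} (hw : EndsWithAscent w) (h : u <:+ w) :
    EndsWithAscent u :=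
  fun a b h' => hw a b (h'.trans h)

/-- A window that touches m either contains the ascent from m into v, or consists of the last two
letters of u and m, and those two letters ascend. -/
theorem NoDoubleDescent.append_cons {u v : List ℤ} {m : ℤ} (hu : NoDoubleDescent u)
    (hu' : EndsWithAscent u) (hv : NoDoubleDescent v) (hm : ∀ y ∈ v, m < y) :
    NoDoubleDescent (u ++ m :: v) := by
  induction u with
  | nil =>
    intro a b c h
    rcases List.infix_cons_iff.1 h with h | h
    · obtain ⟨rfl, h'⟩ := List.cons_prefix_cons.1 h
      have := hm b (h'.subset (by simp : b ∈ [b, c]))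
      omega
    · exact hv a b c h
  | cons x u ih =>
    specialize ih (hu.infix (List.suffix_cons x u).isInfix) (hu'.suffix (List.suffix_cons x u))
    intro a b c h
    rcases List.infix_cons_iff.1 h with h | h
    · obtain ⟨rfl, h'⟩ := List.cons_prefix_cons.1 h
      clear h
      match u, h' with
      | [], h1 =>
        obtain ⟨rfl, h2⟩ := List.cons_prefix_cons.1 h1
        have := hm c (h2.subset (by simp : c ∈ [c]))
        omega
      | [y], h1 =>
        obtain ⟨rfl, h2⟩ := List.cons_prefix_cons.1 h1
        have := hu' a b List.suffix_rfl
        omega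
      | y :: z :: u, h1 =>
        obtain ⟨rfl, h2⟩ := List.cons_prefix_cons.1 h1
        obtain ⟨rfl, h3⟩ := List.cons_prefix_cons.1 h2
        exact hu a b c (List.prefix_append [a, b, c] u).isInfix
    · exact ih a b c h

theorem EndsWithAscent.append_cons {u v : List ℤ} {m : ℤ} (hv : EndsWithAscent v)
    (hm : ∀ y ∈ v, m < y) (h0 : v = [] → u = []) : EndsWithAscent (u ++ m :: v) := by
  intro a b h
  match v with
  | [] =>
    obtain rfl := h0 rfl
    simpa using h.length_le
  | [c] =>
    have h1 : [m, c] <:+ u ++ [m, c] := List.suffix_append _ _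
    have := (List.suffix_of_suffix_length_le h h1 (by simp)).eq_of_length (by simp)
    simp only [List.cons.injEq, and_true] at this
    obtain ⟨rfl, rfl⟩ := this
    exact hm _ (by simp)
  | c :: d :: v =>
    refine hv a b (List.suffix_of_suffix_length_le h ?_ (by simp))
    exact (List.suffix_cons m _).trans (List.suffix_append _ _)

theorem IsIncreasing.isAndre {T : BinaryTree ℤ} (hT : IsIncreasing T) :
    IsAndre (inorder T).reverse := by
  induction T with
  | nil => exact fun t => ⟨noDoubleDescent_nil, endsWithAscent_nil⟩
  | node v l r hl hr =>
    intro t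
    have hT' := hT
    obtain ⟨h1, h2, h3, h4, h5⟩ := hT
    obtain ⟨hl1, hl2⟩ := hl h4 t
    obtain ⟨hr1, hr2⟩ := hr h5 t
    have heq : (inorder (.node v l r)).reverse = (inorder r).reverse ++ v :: (inorder l).reverse := by
      simp [inorder]
    rw [heq]
    have hgt : ∀ y ∈ (inorder l).reverse.filter (· ≤ t), v < y := fun y hy =>
      hT'.lt_of_mem_left (by simpa using (List.mem_filter.1 hy).1)
    by_cases hv : v ≤ t
    · rw [List.filter_append, List.filter_cons_of_pos (by simpa using hv)]
      refine ⟨hr1.append_cons hr2 hl1 hgt, hl2.append_cons hgt fun h0 => ?_⟩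
      -- A surviving label of the right subtree forces its root, hence the smaller left root, to
      -- survive as well.
      by_contra hne
      obtain ⟨x, hx⟩ := List.exists_mem_of_ne_nil _ hne
      simp only [List.mem_filter, List.mem_reverse, decide_eq_true_eq] at hx
      cases hr : rootLabel r with
      | none => simp [rootLabel_eq_none.1 hr, inorder] at hx
      | some y =>
        obtain ⟨z, hz, hzy⟩ := h3 y hr
        have hyx := h5.rootLabel_le hr x hx.1
        have : z ∈ (inorder l).reverse.filter (· ≤ t) := by
          simp only [List.mem_filter, List.mem_reverse, decide_eq_true_eq]
          exact ⟨mem_inorder_of_rootLabel hz, by omega⟩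
        simp [h0] at this
    · have h0 : ((inorder r).reverse ++ v :: (inorder l).reverse).filter (· ≤ t) = [] := by
        rw [List.filter_eq_nil_iff]
        intro x hx
        simp only [List.mem_append, List.mem_reverse, List.mem_cons] at hx
        have : v ≤ x := by
          rcases hx with hx | rfl | hx
          · exact (hT'.lt_of_mem_right hx).le
          · exact le_rfl
          · exact (hT'.lt_of_mem_left hx).le
        simp only [decide_eq_true_eq]; omega
      rw [h0]; exact ⟨noDoubleDescent_nil, endsWithAscent_nil⟩

/-- Cut the word at its minimum m as u, m, v; by induction u is the reading of the right subtree and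
v that of the left one. -/
theorem IsAndre.exists_tree {w : List ℤ} (hw : IsAndre w) (hn : w.Nodup) :
    ∃ T : BinaryTree ℤ, IsIncreasing T ∧ (inorder T).reverse = w := by
  induction hlen : w.length using Nat.strong_induction_on generalizing w with
  | _ n ih =>
  by_cases h0 : w = []
  · exact ⟨.nil, trivial, by simp [h0, inorder]⟩
  obtain ⟨m, hm, hmin⟩ := w.toFinset.exists_min_image id
    (by simpa [List.toFinset_nonempty_iff] using h0)
  simp only [List.mem_toFinset, id] at hm hmin
  obtain ⟨u, v, rfl⟩ := List.append_of_mem hm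
  rw [List.nodup_append, List.nodup_cons] at hn
  obtain ⟨hnu, ⟨hmv, hnv⟩, hdisj⟩ := hn
  have hu : ∀ x ∈ u, m < x := fun x hx =>
    lt_of_le_of_ne (hmin x (by simp [hx])) (hdisj x hx m (by simp)).symm
  have hv : ∀ x ∈ v, m < x := fun x hx =>
    lt_of_le_of_ne (hmin x (by simp [hx])) fun h => hmv (h ▸ hx)
  have key : ∀ t, m ≤ t → (u ++ m :: v).filter (· ≤ t) =
      u.filter (· ≤ t) ++ m :: v.filter (· ≤ t) := fun t ht => by
    rw [List.filter_append, List.filter_cons_of_pos (by simpa using ht)]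
  have small : ∀ t, ¬ m ≤ t → u.filter (· ≤ t) = [] ∧ v.filter (· ≤ t) = [] := fun t ht => by
    simp only [List.filter_eq_nil_iff, decide_eq_true_eq]
    exact ⟨fun x hx => by have := hu x hx; omega, fun x hx => by have := hv x hx; omega⟩
  -- A final descent of the truncated u would continue down to m and give a double descent of w.
  have hAu : IsAndre u := fun t => by
    by_cases ht : m ≤ t
    · have hN := (hw t).1
      rw [key t ht] at hN
      refine ⟨hN.infix (List.prefix_append _ _).isInfix, fun a b hab => ?_⟩
      by_contra hlt
      obtain ⟨s, hs⟩ := hab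
      have hb : b ∈ u.filter (· ≤ t) := by rw [← hs]; simp
      have ha : a ∈ u.filter (· ≤ t) := by rw [← hs]; simp
      have hba : a ≠ b := by
        rintro rfl
        have := hnu.sublist (List.filter_sublist (p := (· ≤ t)))
        rw [← hs] at this
        simp [List.nodup_append] at this
      refine hN a b m ⟨s, v.filter (· ≤ t), ?_⟩ ⟨by omega, hu b (List.mem_filter.1 hb).1⟩
      rw [← hs]; simp
    · rw [(small t ht).1]; exact ⟨noDoubleDescent_nil, endsWithAscent_nil⟩
  have hAv : IsAndre v := fun t => by
    by_cases ht : m ≤ t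
    · have hN := hw t
      rw [key t ht] at hN
      have hs : v.filter (· ≤ t) <:+ u.filter (· ≤ t) ++ m :: v.filter (· ≤ t) :=
        (List.suffix_cons m _).trans (List.suffix_append _ _)
      exact ⟨hN.1.infix hs.isInfix, hN.2.suffix hs⟩
    · rw [(small t ht).2]; exact ⟨noDoubleDescent_nil, endsWithAscent_nil⟩
  simp only [List.length_append, List.length_cons] at hlen
  obtain ⟨R, hR, hRu⟩ := ih _ (by omega) hAu hnu rfl
  obtain ⟨L, hL, hLv⟩ := ih _ (by omega) hAv hnv rfl
  have memR : ∀ x, x ∈ inorder R ↔ x ∈ u := fun x => by rw [← hRu]; simp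
  have memL : ∀ x, x ∈ inorder L ↔ x ∈ v := fun x => by rw [← hLv]; simp
  refine ⟨.node m L R, ⟨fun x hx => hv x ((memL x).1 (mem_inorder_of_rootLabel hx)),
    fun x hx => hu x ((memR x).1 (mem_inorder_of_rootLabel hx)), fun y hy => ?_, hL, hR⟩,
    by simp [inorder, hRu, hLv]⟩
  have hyu := (memR y).1 (mem_inorder_of_rootLabel hy)
  have hN := (hw y).2
  rw [key y (hu y hyu).le] at hN
  -- Truncate at the root y of the right subtree: if nothing of v survived, the word would end with
  -- the descent from a letter of u to m.
  have hex : ∃ x ∈ v, x ≤ y := by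
    by_contra! hne
    have h0 : v.filter (· ≤ y) = [] := by
      simp only [List.filter_eq_nil_iff, decide_eq_true_eq, not_le]; exact hne
    rw [h0] at hN
    have hune : u.filter (· ≤ y) ≠ [] :=
      List.ne_nil_of_mem (List.mem_filter.2 ⟨hyu, by simp⟩)
    obtain ⟨s, z, hs⟩ := List.eq_nil_or_concat _ |>.resolve_left hune
    have hz : z ∈ u.filter (· ≤ y) := by rw [hs]; simp
    have := hN z m ⟨s, by rw [hs]; simp⟩
    have := hu z (List.mem_filter.1 hz).1
    omega
  obtain ⟨x, hxv, hxy⟩ := hex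
  cases hr : rootLabel L with
  | none =>
    have := (memL x).2 hxv
    simp [rootLabel_eq_none.1 hr, inorder] at this
  | some z =>
    refine ⟨z, rfl, lt_of_le_of_ne ((hL.rootLabel_le hr x ((memL x).2 hxv)).trans hxy) ?_⟩
    rintro rfl
    exact hdisj z hyu z (by simp [(memL z).1 (mem_inorder_of_rootLabel hr)]) rfl

/-- The root is the least label, so the word determines it, and it cuts the word into the readings
of the two subtrees. -/
theorem IsIncreasing.eq_of_inorder_eq {α : Type*} [PartialOrder α] {T T' : BinaryTree α}
    (hT : IsIncreasing T) (hT' : IsIncreasing T') (hn : (inorder T).Nodup)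
    (h : inorder T = inorder T') : T = T' := by
  induction T generalizing T' with
  | nil => cases T' <;> simp_all [inorder]
  | node v l r hl hr =>
    cases T' with
    | nil => simp [inorder] at h
    | node v' l' r' =>
      have e : v = v' := le_antisymm
        (hT.rootLabel_le rfl v' (by rw [h]; simp [inorder]))
        (hT'.rootLabel_le rfl v (by rw [← h]; simp [inorder]))
      subst e
      have h1 : v ∉ inorder l := fun hv => (hT.lt_of_mem_left hv).false
      have h2 : v ∉ inorder l' := fun hv => (hT'.lt_of_mem_left hv).false
      simp only [inorder] at h hn
      have h3 : v ∉ inorder r := fun hv => (hT.lt_of_mem_right hv).false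
      have h4 : v ∉ inorder r' := fun hv => (hT'.lt_of_mem_right hv).false
      -- The root label v occurs in none of the four pieces, so the overlap s of the two
      -- factorizations is empty.
      obtain ⟨e1, e2⟩ : inorder l = inorder l' ∧ inorder r = inorder r' := by
        rcases List.append_eq_append_iff.1 h with ⟨s, hs1, hs2⟩ | ⟨s, hs1, hs2⟩ <;>
          cases s <;> simp_all
      rw [List.nodup_append, List.nodup_cons] at hn
      rw [hl hT.2.2.2.1 hT'.2.2.2.1 hn.1 e1, hr hT.2.2.2.2 hT'.2.2.2.2 hn.2.1.2 e2]

end ReverseInorder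

/-! ### Grafting, rotating and exchanging labels at the minimal leaf -/

section TreeSurgery

/-- Some vertex `a` of the minimal path has left child `b`. -/
def HasPathEdge (a b : ℕ) : BinaryTree ℕ → Prop
  | .nil => False
  | .node v l _ => (v = a ∧ rootLabel l = some b) ∨ HasPathEdge a b l

/-- The vertex `a` of the minimal path has a right child, which could take the place of `a`
in an increasing 1-2 tree. -/
def IsGrafted (a : ℕ) : BinaryTree ℕ → Prop
  | .nil => False
  | .node v l r =>
      if v = a then r ≠ .nil
      else if rootLabel l = some a then
        l.right ≠ .nil ∧ ∀ y ∈ rootLabel r, ∃ x ∈ rootLabel l.right, x < y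
      else IsGrafted a l

/-- Replace the subtree at the vertex `a` of the minimal path by the right subtree of `a`. -/
def ungraft (a : ℕ) : BinaryTree ℕ → BinaryTree ℕ
  | .nil => .nil
  | .node v l r => if v = a then r else .node v (ungraft a l) r

/-- The inverse of `rotate (a + 1)`. -/
def unrotate (a : ℕ) : BinaryTree ℕ → BinaryTree ℕ
  | .nil => .nil
  | .node v l r =>
      if rootLabel l = some a then
        .node v (.node a .nil .nil) (.node (a + 1) r l.right)
      else .node v (unrotate a l) r

variable {a b v : ℕ} {T l r : BinaryTree ℕ}

theorem HasPathEdge.mem (h : HasPathEdge a b T) : a ∈ inorder T := by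
  induction T with
  | nil => exact h.elim
  | node v l r hl hr =>
    rcases h with ⟨rfl, -⟩ | h
    · simp [inorder]
    · simp [inorder, hl h]

theorem HasPathEdge.lt (h : HasPathEdge a b T) (hT : IsIncreasing T) : a < b := by
  induction T with
  | nil => exact h.elim
  | node v l r hl hr =>
    rcases h with ⟨rfl, h⟩ | h
    · exact hT.1 b h
    · exact hl h hT.2.2.2.1

theorem HasPathEdge.minLeaf_ne (h : HasPathEdge a b T) (hT : IsIncreasing T) :
    minLeaf T ≠ some a := by
  induction T with
  | nil => exact h.elim
  | node v l r hl hr =>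
    intro hm
    rcases h with ⟨rfl, h⟩ | h
    · rcases minLeaf_node hm with h' | ⟨rfl, -⟩
      · exact (hT.lt_of_mem_left (mem_inorder_of_minLeaf h')).false
      · simp [rootLabel] at h
    · rcases minLeaf_node hm with h' | ⟨rfl, -⟩
      · exact hl h hT.2.2.2.1 h'
      · exact h.elim

theorem areSiblings_node : areSiblings a b (.node v l r) = true ↔
    (rootLabel l = some a ∧ rootLabel r = some b) ∨ areSiblings a b l = true ∨
      areSiblings a b r = true := by
  simp [areSiblings, or_assoc]

theorem mem_of_areSiblings (h : areSiblings a b T = true) : a ∈ inorder T ∧ b ∈ inorder T := by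
  induction T with
  | nil => simp [areSiblings] at h
  | node v l r hl hr =>
    simp only [inorder, List.mem_append, List.mem_cons]
    rcases areSiblings_node.1 h with h | h | h
    · exact ⟨.inl (mem_inorder_of_rootLabel h.1), .inr (.inr (mem_inorder_of_rootLabel h.2))⟩
    · exact ⟨.inl (hl h).1, .inl (hl h).2⟩
    · exact ⟨.inr (.inr (hr h).1), .inr (.inr (hr h).2)⟩

theorem lt_of_areSiblings (h : areSiblings a b T = true) (hT : IsIncreasing T) : a < b := by
  induction T with
  | nil => simp [areSiblings] at h
  | node v l r hl hr =>
    rcases areSiblings_node.1 h with h | h | h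
    · obtain ⟨x, hx, hxb⟩ := hT.2.2.1 b h.2
      obtain rfl : a = x := by simpa [h.1] using hx
      exact hxb
    · exact hl h hT.2.2.2.1
    · exact hr h hT.2.2.2.2

theorem rootLabel_ne_of_areSiblings (h : areSiblings a b T = true) (hT : IsIncreasing T) :
    rootLabel T ≠ some a := by
  cases T with
  | nil => simp [rootLabel]
  | node v l r =>
    simp only [rootLabel, ne_eq, Option.some.injEq]
    rintro rfl
    rcases areSiblings_node.1 h with h | h | h
    · exact (hT.lt_of_mem_left (mem_inorder_of_rootLabel h.1)).false
    · exact (hT.lt_of_mem_left (mem_of_areSiblings h).1).false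
    · exact (hT.lt_of_mem_right (mem_of_areSiblings h).1).false

theorem notMem_right_of_mem_left (hn : (inorder (.node v l r)).Nodup) {x : ℕ}
    (hx : x ∈ inorder l) : x ∉ inorder r := by
  intro hr
  simp only [inorder, List.nodup_append, List.mem_cons] at hn
  exact hn.2.2 x hx x (.inr hr) rfl

theorem nodup_left (hn : (inorder (.node v l r)).Nodup) : (inorder l).Nodup := by
  simp only [inorder, List.nodup_append] at hn
  exact hn.1

theorem areSiblings_right_false (hn : (inorder (.node v l r)).Nodup)
    (hT : IsIncreasing (.node v l r)) {x : ℕ} (hm : minLeaf (.node v l r) = some x)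
    (hx : x ∈ inorder r) : False := by
  rcases minLeaf_node hm with h | ⟨-, rfl⟩
  · exact notMem_right_of_mem_left hn (mem_inorder_of_minLeaf h) hx
  · exact (hT.lt_of_mem_right hx).false

theorem not_areSiblings_of_minLeaf (hn : (inorder T).Nodup) (hT : IsIncreasing T)
    (hm : minLeaf T = some b) : ¬ areSiblings a b T = true := by
  induction T with
  | nil => simp [areSiblings]
  | node v l r hl hr =>
    intro h
    rcases areSiblings_node.1 h with h | h | h
    · exact areSiblings_right_false hn hT hm (mem_inorder_of_rootLabel h.2)
    · rcases minLeaf_node hm with h' | ⟨rfl, -⟩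
      · exact hl (nodup_left hn) hT.2.2.2.1 h' h
      · simp [areSiblings] at h
    · exact areSiblings_right_false hn hT hm (mem_of_areSiblings h).2

/-- An only child is a left child, so a vertex without left subtree is a leaf. -/
theorem eq_leaf_of_rootLabel_of_minLeaf (hT : IsIncreasing T) (hr : rootLabel T = some b)
    (hm : minLeaf T = some b) : T = .node b .nil .nil := by
  cases T with
  | nil => simp [rootLabel] at hr
  | node v l r =>
    simp only [rootLabel, Option.some.injEq] at hr
    subst hr
    rcases minLeaf_node hm with h' | ⟨rfl, -⟩
    · exact ((hT.lt_of_mem_left (mem_inorder_of_minLeaf h')).false).elim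
    · cases r with
      | nil => rfl
      | node y _ _ =>
        obtain ⟨x, hx, -⟩ := hT.2.2.1 y rfl
        simp [rootLabel] at hx

theorem swap_lt_swap {x y : ℕ} (h : x < y) (hxy : ¬ (x = a ∧ y = a + 1)) :
    Equiv.swap a (a + 1) x < Equiv.swap a (a + 1) y := by
  simp only [Equiv.swap_apply_def]
  split_ifs <;> omega

/-- Exchanging the labels `a` and `a + 1`, one of which is the minimal leaf, keeps a tree increasing
unless they are parent and child or siblings. -/
theorem IsIncreasing.map_swap {x : ℕ} (hT : IsIncreasing T) (hn : (inorder T).Nodup)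
    (hm : minLeaf T = some x) (hx : x = a ∨ x = a + 1) (he : ¬ HasPathEdge a (a + 1) T)
    (hs : ¬ areSiblings a (a + 1) T = true) : IsIncreasing (T.map (Equiv.swap a (a + 1))) := by
  induction T with
  | nil => trivial
  | node v l r hl hr =>
    rw [areSiblings_node] at hs
    simp only [HasPathEdge, not_or] at he hs
    obtain ⟨h1, h2, h3, h4, h5⟩ := id hT
    have hxr : x ∉ inorder r := fun h => areSiblings_right_false hn hT hm h
    refine ⟨?_, ?_, ?_, ?_, h5.map fun y hy z hz hyz => swap_lt_swap hyz ?_⟩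
    · simp only [rootLabel_map, Option.mem_def, Option.map_eq_some_iff]
      rintro _ ⟨y, hy, rfl⟩
      refine swap_lt_swap (h1 y hy) ?_
      rintro ⟨rfl, rfl⟩
      exact he.1 ⟨rfl, hy⟩
    · simp only [rootLabel_map, Option.mem_def, Option.map_eq_some_iff]
      rintro _ ⟨y, hy, rfl⟩
      refine swap_lt_swap (h2 y hy) ?_
      rintro ⟨rfl, rfl⟩
      -- If a + 1 were a right child of a, its left sibling would lie strictly between a and a + 1.
      obtain ⟨z, hz, hzy⟩ := h3 _ hy
      have := h1 z hz
      omega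
    · simp only [rootLabel_map, Option.mem_def, Option.map_eq_some_iff]
      rintro _ ⟨y, hy, rfl⟩
      obtain ⟨z, hz, hzy⟩ := h3 _ hy
      refine ⟨_, ⟨z, hz, rfl⟩, swap_lt_swap hzy ?_⟩
      rintro ⟨rfl, rfl⟩
      exact hs.1 ⟨hz, hy⟩
    · rcases minLeaf_node hm with h' | ⟨rfl, -⟩
      · exact hl h4 (nodup_left hn) h' he.2 hs.2.1
      · trivial
    · rintro ⟨rfl, rfl⟩
      rcases hx with rfl | rfl
      exacts [hxr hy, hxr hz]

theorem hasPathEdge_map_swap : HasPathEdge a b (T.map (Equiv.swap a b)) ↔ HasPathEdge b a T := by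
  induction T with
  | nil => rfl
  | node v l r hl hr =>
    simp only [BinaryTree.map, HasPathEdge, hl, rootLabel_map, Option.map_eq_some_iff]
    refine or_congr_left (and_congr ?_ ?_)
    · rw [Equiv.swap_apply_eq_iff, Equiv.swap_apply_left]
    · simp [Equiv.swap_apply_eq_iff]

theorem areSiblings_map_swap : areSiblings a b (T.map (Equiv.swap a b)) = true ↔
    areSiblings b a T = true := by
  induction T with
  | nil => rfl
  | node v l r hl hr =>
    simp [BinaryTree.map, areSiblings_node, hl, hr, rootLabel_map, Option.map_eq_some_iff,
      Equiv.swap_apply_eq_iff]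

/-- The bound `ham` guarantees a vertex above a + 1 on the minimal path, so the recursion of `graft`
never runs off the tree. -/
theorem graft_spec {m : ℕ} (hT : IsIncreasing T) (h1 : a ∉ inorder T) (h2 : a + 1 ∉ inorder T)
    (hm : minLeaf T = some m) (ham : a + 1 < m) :
    IsIncreasing (graft (a + 1) T) ∧ (inorder (graft (a + 1) T)).Perm (a :: (a + 1) :: inorder T) ∧
    minLeaf (graft (a + 1) T) = some (a + 1) ∧ HasPathEdge a (a + 1) (graft (a + 1) T) ∧
    IsGrafted a (graft (a + 1) T) ∧ ungraft a (graft (a + 1) T) = T := by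
  induction T with
  | nil => simp [minLeaf] at hm
  | node v l r hl hr =>
    by_cases hv : a + 1 < v
    · simp only [graft, if_pos hv, add_tsub_cancel_right]
      refine ⟨⟨by simp [rootLabel], by simp [rootLabel]; omega, by simpa [rootLabel] using hv,
        by simp [IsIncreasing, rootLabel], hT⟩, ?_, by simp [minLeaf],
        by simp [HasPathEdge, rootLabel], by simp [IsGrafted], by simp [ungraft]⟩
      exact List.Perm.swap a (a + 1) (inorder (.node v l r))
    · simp only [inorder, List.mem_append, List.mem_cons, not_or] at h1 h2
      rcases minLeaf_node hm with h' | ⟨rfl, rfl⟩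
      swap
      · omega
      obtain ⟨g1, g2, g3, g4, g5, g6⟩ := hl hT.2.2.2.1 h1.1 h2.1 h'
      have hva : v < a := by omega
      -- The left root can only change from x to the smaller a, so the order between siblings
      -- survives.
      have hroot : ∃ x, rootLabel l = some x ∧
          rootLabel (graft (a + 1) l) = some (if a + 1 < x then a else x) := by
        cases l with
        | nil => simp [minLeaf] at h'
        | node x l' r' =>
          refine ⟨x, rfl, ?_⟩
          simp only [graft]
          split_ifs <;> rfl
      obtain ⟨x, hx, hx'⟩ := hroot
      have hvx := hT.1 x hx
      have hxa : x ≠ a := fun h => h1.1 (h ▸ mem_inorder_of_rootLabel hx)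
      simp only [graft, if_neg hv]
      refine ⟨⟨?_, hT.2.1, ?_, g1, hT.2.2.2.2⟩, ?_, minLeaf_node_of_some g3, .inr g4, ?_, ?_⟩
      · rw [hx']
        simp only [Option.mem_def, Option.some.injEq, forall_eq']
        split_ifs <;> omega
      · intro y hy
        obtain ⟨z, hz, hzy⟩ := hT.2.2.1 y hy
        obtain rfl : x = z := by simpa [hx] using hz
        refine ⟨_, hx', ?_⟩
        split_ifs <;> omega
      · simp only [inorder]
        exact g2.append_right _
      · simp only [IsGrafted, if_neg hva.ne, hx', Option.some.injEq]
        -- If a has become the left child of v, its right child is the old left child of v, which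
        -- was already smaller than the right child of v.
        split_ifs with c1 c2
        · cases l with
          | nil => simp [minLeaf] at h'
          | node y l' r' =>
            simp only [rootLabel, Option.some.injEq] at hx
            subst hx
            simp only [graft, if_pos c1, BinaryTree.right]
            exact ⟨by simp, fun z hz => hT.2.2.1 z hz⟩
        · exact absurd rfl c2
        · exact g5
      · simp only [ungraft, if_neg hva.ne, g6]

theorem ungraft_spec (hT : IsIncreasing T) (hm : minLeaf T = some (a + 1))
    (he : HasPathEdge a (a + 1) T) (hg : IsGrafted a T) :
    IsIncreasing (ungraft a T) ∧ (inorder T).Perm (a :: (a + 1) :: inorder (ungraft a T)) ∧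
    (∃ m, minLeaf (ungraft a T) = some m ∧ a + 1 < m) ∧ graft (a + 1) (ungraft a T) = T := by
  induction T with
  | nil => simp [minLeaf] at hm
  | node v l r hl hr =>
    by_cases hv : v = a
    · subst hv
      have hlv : rootLabel l = some (v + 1) := by
        rcases he with he | he
        · exact he.2
        · exact ((hT.lt_of_mem_left he.mem).false).elim
      have hml : minLeaf l = some (v + 1) := by
        rcases minLeaf_node hm with h' | ⟨-, h'⟩
        · exact h'
        · omega
      obtain rfl := eq_leaf_of_rootLabel_of_minLeaf hT.2.2.2.1 hlv hml
      simp only [IsGrafted, if_true] at hg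
      simp only [ungraft, if_true]
      cases r with
      | nil => exact absurd rfl hg
      | node x l' r' =>
        have hx : v + 1 < x := by
          obtain ⟨z, hz, hzx⟩ := hT.2.2.1 x rfl
          simp only [rootLabel, Option.mem_def, Option.some.injEq] at hz
          omega
        refine ⟨hT.2.2.2.2, List.Perm.swap _ _ _, ⟨_, rfl, ?_⟩, by simp [graft, hx]⟩
        exact hx.trans_le (hT.2.2.2.2.rootLabel_le rfl _ (mem_inorder_of_minLeaf rfl))
    · have he' : HasPathEdge a (a + 1) l := he.resolve_left fun h => hv h.1
      have hml : minLeaf l = some (a + 1) := by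
        rcases minLeaf_node hm with h' | ⟨rfl, h'⟩
        · exact h'
        · exact he'.elim
      have hva : v < a := hT.lt_of_mem_left he'.mem
      simp only [IsGrafted, if_neg hv] at hg
      have hgl : IsGrafted a l := by
        split_ifs at hg with h
        · cases l with
          | nil => simp [rootLabel] at h
          | node y l' r' =>
            simp only [rootLabel, Option.some.injEq] at h
            simpa [IsGrafted, h] using hg.1
        · exact hg
      obtain ⟨g1, g2, ⟨m, g3, g3'⟩, g4⟩ := hl hT.2.2.2.1 hml he' hgl
      simp only [ungraft, if_neg hv]
      refine ⟨⟨?_, hT.2.1, ?_, g1, hT.2.2.2.2⟩, ?_, ⟨m, minLeaf_node_of_some g3, g3'⟩, ?_⟩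
      · intro x hx
        refine hT.lt_of_mem_left (g2.symm.subset ?_)
        simp [mem_inorder_of_rootLabel hx]
      · split_ifs at hg with h
        · cases l with
          | nil => simp [rootLabel] at h
          | node y l' r' =>
            simp only [rootLabel, Option.some.injEq] at h
            simp only [ungraft, if_pos h]
            exact hg.2
        · cases l with
          | nil => simp [minLeaf] at hml
          | node y l' r' =>
            simp only [rootLabel, Option.some.injEq] at h
            simp only [ungraft, if_neg h]
            exact hT.2.2.1
      · simp only [inorder]
        exact g2.append_right _
      · simp only [graft, if_neg (show ¬ a + 1 < v by omega), g4]

theorem rootLabel_rotate (k : ℕ) : rootLabel (rotate k T) = rootLabel T := by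
  cases T with
  | nil => rfl
  | node v l r => simp only [rotate]; split_ifs <;> rfl

theorem rootLabel_unrotate : rootLabel (unrotate a T) = rootLabel T := by
  cases T with
  | nil => rfl
  | node v l r => simp only [unrotate]; split_ifs <;> rfl

/-- Let A and B be the subtrees above a + 1. After the rotation B sits above a and A is the sibling
of a. As B was the right sibling of A, it cannot replace a to the left of A: rotated trees are
exactly the non-grafted ones. -/
theorem rotate_spec (hT : IsIncreasing T) (hn : (inorder T).Nodup) (hm : minLeaf T = some a)
    (hs : areSiblings a (a + 1) T = true) :
    IsIncreasing (rotate (a + 1) T) ∧ (inorder (rotate (a + 1) T)).Perm (inorder T) ∧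
    minLeaf (rotate (a + 1) T) = some (a + 1) ∧ HasPathEdge a (a + 1) (rotate (a + 1) T) ∧
    ¬ IsGrafted a (rotate (a + 1) T) ∧ unrotate a (rotate (a + 1) T) = T := by
  induction T with
  | nil => simp [minLeaf] at hm
  | node v l r hl hr =>
    by_cases hlr : rootLabel l = some a ∧ rootLabel r = some (a + 1)
    · have hva := hT.1 a hlr.1
      have hml : minLeaf l = some a := by
        rcases minLeaf_node hm with h' | ⟨-, h'⟩
        · exact h'
        · omega
      obtain rfl := eq_leaf_of_rootLabel_of_minLeaf hT.2.2.2.1 hlr.1 hml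
      cases r with
      | nil => simp [rootLabel] at hlr
      | node y A B =>
        simp only [rootLabel, Option.some.injEq, true_and] at hlr
        subst hlr
        obtain ⟨hA, hB, hAB, hA', hB'⟩ := hT.2.2.2.2
        simp only [rotate, rootLabel, add_tsub_cancel_right, true_and, if_true,
          BinaryTree.left, BinaryTree.right]
        refine ⟨⟨by simpa [rootLabel] using hva, fun y hy => ?_, fun y hy => ⟨a, rfl, ?_⟩,
          ⟨by simp [rootLabel], fun y hy => ?_, fun y hy => ⟨_, rfl, hB y hy⟩,
            by simp [IsIncreasing, rootLabel], hB'⟩, hA'⟩, ?_, by simp [minLeaf],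
            .inr (.inl ⟨rfl, rfl⟩), ?_, by simp [unrotate, rootLabel]⟩
        · have := hA y hy; omega
        · have := hA y hy; omega
        · have := hB y hy; omega
        · rw [List.perm_iff_count]
          intro z
          simp only [inorder, List.count_append, List.count_cons, List.count_nil]
          omega
        · simp only [IsGrafted, if_neg hva.ne, rootLabel, if_true, BinaryTree.right]
          rintro ⟨hne, hlt⟩
          cases B with
          | nil => exact hne rfl
          | node z _ _ =>
            obtain ⟨x, hx, hxz⟩ := hAB z rfl
            obtain ⟨z', hz', hz'x⟩ := hlt x hx
            simp only [Option.mem_def, Option.some.injEq] at hz'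
            omega
    · have hsl : areSiblings a (a + 1) l = true := by
        rcases areSiblings_node.1 hs with h | h | h
        · exact absurd h hlr
        · exact h
        · exact (areSiblings_right_false hn hT hm (mem_of_areSiblings h).1).elim
      have hml : minLeaf l = some a := by
        rcases minLeaf_node hm with h' | ⟨rfl, h'⟩
        · exact h'
        · simp [areSiblings] at hsl
      obtain ⟨g1, g2, g3, g4, g5, g6⟩ := hl hT.2.2.2.1 (nodup_left hn) hml hsl
      have hva : v < a := hT.lt_of_mem_left (mem_of_areSiblings hsl).1
      have hla := rootLabel_ne_of_areSiblings hsl hT.2.2.2.1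
      simp only [rotate, add_tsub_cancel_right, if_neg hlr]
      refine ⟨⟨?_, hT.2.1, ?_, g1, hT.2.2.2.2⟩, ?_, minLeaf_node_of_some g3, .inr g4, ?_, ?_⟩
      · rw [rootLabel_rotate]; exact hT.1
      · rw [rootLabel_rotate]; exact hT.2.2.1
      · simp only [inorder]
        exact g2.append_right _
      · simp only [IsGrafted, if_neg hva.ne, rootLabel_rotate, if_neg hla, g5, not_false_iff]
      · simp only [unrotate, rootLabel_rotate, if_neg hla, g6]

theorem unrotate_spec (hT : IsIncreasing T) (hn : (inorder T).Nodup)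
    (hm : minLeaf T = some (a + 1)) (he : HasPathEdge a (a + 1) T) (hg : ¬ IsGrafted a T)
    (hroot : rootLabel T ≠ some a) :
    IsIncreasing (unrotate a T) ∧ (inorder (unrotate a T)).Perm (inorder T) ∧
    minLeaf (unrotate a T) = some a ∧ areSiblings a (a + 1) (unrotate a T) = true ∧
    rotate (a + 1) (unrotate a T) = T := by
  induction T with
  | nil => simp [minLeaf] at hm
  | node v l r hl hr =>
    simp only [rootLabel, ne_eq, Option.some.injEq] at hroot
    have he' : HasPathEdge a (a + 1) l := he.resolve_left fun h => hroot h.1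
    have hml : minLeaf l = some (a + 1) := by
      rcases minLeaf_node hm with h' | ⟨rfl, h'⟩
      · exact h'
      · exact he'.elim
    have hva : v < a := hT.lt_of_mem_left he'.mem
    simp only [IsGrafted, if_neg hroot] at hg
    by_cases hla : rootLabel l = some a
    · cases l with
      | nil => simp [rootLabel] at hla
      | node y l' B =>
        simp only [rootLabel, Option.some.injEq] at hla
        subst hla
        have hl'y : rootLabel l' = some (y + 1) := by
          rcases he' with h | h
          · exact h.2
          · exact ((hT.2.2.2.1.lt_of_mem_left h.mem).false).elim
        have hml' : minLeaf l' = some (y + 1) := by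
          rcases minLeaf_node hml with h' | ⟨-, h'⟩
          · exact h'
          · omega
        obtain rfl := eq_leaf_of_rootLabel_of_minLeaf hT.2.2.2.1.2.2.2.1 hl'y hml'
        simp only [rootLabel, if_true, BinaryTree.right] at hg
        simp only [unrotate, rootLabel, if_true, BinaryTree.right]
        obtain ⟨h1, h2, h3, h4, h5⟩ := id hT
        have hB : ∀ z ∈ rootLabel B, y + 1 < z := fun z hz => by
          obtain ⟨x, hx, hxz⟩ := h4.2.2.1 z hz
          simp only [rootLabel, Option.mem_def, Option.some.injEq] at hx
          omega
        have hr : ∀ z ∈ rootLabel r, y + 1 < z := fun z hz => by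
          obtain ⟨x, hx, hxz⟩ := h3 z hz
          simp only [rootLabel, Option.mem_def, Option.some.injEq] at hx
          have : z ≠ y + 1 := by
            rintro rfl
            exact notMem_right_of_mem_left hn (by simp [inorder]) (mem_inorder_of_rootLabel hz)
          omega
        refine ⟨⟨by simpa [rootLabel] using hva, by simp [rootLabel]; omega,
          by simp [rootLabel], by simp [IsIncreasing, rootLabel], hr, hB, fun z hz => ?_, h5,
            h4.2.2.2.2⟩, ?_, by simp [minLeaf], areSiblings_node.2 (.inl ⟨rfl, rfl⟩),
            by simp [rotate, rootLabel]⟩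
        · have hne : B ≠ .nil := by rintro rfl; simp [rootLabel] at hz
          -- Failure of `IsGrafted` with B nonempty means that B cannot stand to the left of r;
          -- since the labels are distinct, r can then stand to the left of B.
          simp only [not_and, not_forall] at hg
          obtain ⟨x, hx, hxz⟩ := hg hne
          refine ⟨x, hx, lt_of_le_of_ne (not_lt.1 fun h => hxz ⟨z, hz, h⟩) ?_⟩
          rintro rfl
          exact notMem_right_of_mem_left hn (by simp [inorder, mem_inorder_of_rootLabel hz])
            (mem_inorder_of_rootLabel hx)
        · rw [List.perm_iff_count]
          intro z
          simp only [inorder, List.count_append, List.count_cons, List.count_nil]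
          omega
    · rw [if_neg hla] at hg
      obtain ⟨g1, g2, g3, g4, g5⟩ := hl hT.2.2.2.1 (nodup_left hn) hml he' hg hla
      simp only [unrotate, if_neg hla]
      refine ⟨⟨?_, hT.2.1, ?_, g1, hT.2.2.2.2⟩, ?_, minLeaf_node_of_some g3,
        areSiblings_node.2 (.inr (.inl g4)), ?_⟩
      · rw [rootLabel_unrotate]; exact hT.1
      · rw [rootLabel_unrotate]; exact hT.2.2.1
      · simp only [inorder]
        exact g2.append_right _
      · simp only [rotate, rootLabel_unrotate, add_tsub_cancel_right, hla, false_and, if_false, g5]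

end TreeSurgery

/-! ### The bijection on labels 1, …, n -/

section StandardLabels

/-- Down-up permutations of `[n]` with first entry `k`. -/
def downUpPerms (n k : ℕ) : Set (List ℕ) :=
  {w | w.Perm (List.range' 1 n) ∧ IsDownUp w ∧ w.head? = some k}

/-- Increasing 1-2 trees on `[n]` with minimal leaf `k`. -/
def increasingTrees (n k : ℕ) : Set (BinaryTree ℕ) :=
  {T | IsIncreasing T ∧ (inorder T).Perm (List.range' 1 n) ∧ minLeaf T = some k}

/-- The order-preserving map from `ℕ` to the complement of `{a, a + 1}`. -/
def expand (a x : ℕ) : ℕ := if x + 1 < a + 1 then x else x + 2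

/-- The inverse of `expand a`. -/
def shrink (a x : ℕ) : ℕ := if a + 1 < x then x - 2 else x

/-- The step of `psi` for down-up permutations whose second entry is not `a`, where the first entry
is `a + 1`. -/
def rotateOrSwap (a : ℕ) (T : BinaryTree ℕ) : BinaryTree ℕ :=
  if areSiblings a (a + 1) T then rotate (a + 1) T else T.map (Equiv.swap a (a + 1))

theorem shrink_expand (a x : ℕ) : shrink a (expand a x) = x := by
  simp only [shrink, expand]; split_ifs <;> omega

theorem expand_shrink {a x : ℕ} (h : x ≠ a) (h' : x ≠ a + 1) : expand a (shrink a x) = x := by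
  simp only [shrink, expand]; split_ifs <;> omega

theorem expand_ne (a x : ℕ) : expand a x ≠ a ∧ expand a x ≠ a + 1 := by
  simp only [expand]; split_ifs <;> omega

theorem expand_lt_expand {a x y : ℕ} (h : x < y) : expand a x < expand a y := by
  simp only [expand]; split_ifs <;> omega

theorem shrink_lt_shrink {a x y : ℕ} (hx : x ≠ a ∧ x ≠ a + 1) (hy : y ≠ a ∧ y ≠ a + 1)
    (h : x < y) : shrink a x < shrink a y := by
  simp only [shrink]; split_ifs <;> omega

theorem perm_range'_iff {n : ℕ} {w : List ℕ} :
    w.Perm (List.range' 1 n) ↔ w.Nodup ∧ ∀ x, x ∈ w ↔ 1 ≤ x ∧ x ≤ n := by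
  constructor
  · intro h
    refine ⟨h.nodup_iff.2 List.nodup_range', fun x => ?_⟩
    rw [h.mem_iff, List.mem_range'_1]; omega
  · rintro ⟨h1, h2⟩
    refine (List.perm_ext_iff_of_nodup h1 List.nodup_range').2 fun x => ?_
    rw [h2, List.mem_range'_1]; omega

theorem perm_expand {m a : ℕ} (h1 : 1 ≤ a) (ha : a ≤ m + 1) {w : List ℕ}
    (hw : w.Perm (List.range' 1 m)) :
    (a :: (a + 1) :: w.map (expand a)).Perm (List.range' 1 (m + 2)) := by
  rw [perm_range'_iff] at hw ⊢
  obtain ⟨hn, hmem⟩ := hw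
  refine ⟨?_, fun x => ?_⟩
  · simp only [List.nodup_cons, List.mem_cons, List.mem_map, not_or, not_exists, not_and]
    exact ⟨⟨by omega, fun x _ h => (expand_ne a x).1 h⟩, fun x _ h => (expand_ne a x).2 h,
      hn.map (Function.LeftInverse.injective (shrink_expand a))⟩
  · simp only [List.mem_cons, List.mem_map, hmem]
    constructor
    · rintro (rfl | rfl | ⟨y, hy, rfl⟩)
      · omega
      · omega
      · simp only [expand]; split_ifs <;> omega
    · intro hx
      by_cases h : x = a
      · exact .inl h
      by_cases h' : x = a + 1
      · exact .inr (.inl h')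
      refine .inr (.inr ⟨shrink a x, ?_, expand_shrink h h'⟩)
      simp only [shrink]; split_ifs <;> omega

theorem perm_shrink {m a : ℕ} {w : List ℕ}
    (hw : (a :: (a + 1) :: w).Perm (List.range' 1 (m + 2))) :
    (w.map (shrink a)).Perm (List.range' 1 m) := by
  rw [perm_range'_iff] at hw ⊢
  obtain ⟨hn, hmem⟩ := hw
  simp only [List.nodup_cons, List.mem_cons, not_or] at hn
  have h1 := (hmem a).1 (by simp)
  have h2 := (hmem (a + 1)).1 (by simp)
  have hne : ∀ x ∈ w, x ≠ a ∧ x ≠ a + 1 := fun x hx =>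
    ⟨fun h => hn.1.2 (h ▸ hx), fun h => hn.2.1 (h ▸ hx)⟩
  refine ⟨hn.2.2.map_on fun x hx y hy h => ?_, fun x => ?_⟩
  · rw [← expand_shrink (hne x hx).1 (hne x hx).2, h, expand_shrink (hne y hy).1 (hne y hy).2]
  · rw [List.mem_map]
    constructor
    · rintro ⟨y, hy, rfl⟩
      have := (hmem y).1 (by simp [hy])
      have := hne y hy
      simp only [shrink]; split_ifs <;> omega
    · intro hx
      refine ⟨expand a x, ?_, shrink_expand a x⟩
      have := (hmem (expand a x)).2 (by simp only [expand]; split_ifs <;> omega)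
      simpa [expand_ne a x] using this

theorem perm_swap {n a : ℕ} (h1 : 1 ≤ a) (ha : a + 1 ≤ n) {w : List ℕ}
    (hw : w.Perm (List.range' 1 n)) :
    (w.map (Equiv.swap a (a + 1))).Perm (List.range' 1 n) := by
  rw [perm_range'_iff] at hw ⊢
  refine ⟨hw.1.map (Equiv.injective _), fun x => ?_⟩
  rw [List.mem_map]
  constructor
  · rintro ⟨y, hy, rfl⟩
    rw [hw.2] at hy
    simp only [Equiv.swap_apply_def]; split_ifs <;> omega
  · intro hx
    refine ⟨Equiv.swap a (a + 1) x, ?_, Equiv.swap_apply_self _ _ _⟩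
    rw [hw.2]
    simp only [Equiv.swap_apply_def]; split_ifs <;> omega

theorem isDownUp_cons_cons_cons {α : Type*} [LT α] {a b c : α} {w : List α} :
    IsDownUp (a :: b :: c :: w) ↔ b < a ∧ b < c ∧ IsDownUp (c :: w) := Iff.rfl

theorem IsDownUp.map {α β : Type*} [LT α] [LT β] {f : α → β} : ∀ {w : List α}, IsDownUp w →
    (∀ x ∈ w, ∀ y ∈ w, x < y → f x < f y) → IsDownUp (w.map f)
  | [], _, _ => trivial
  | [_], _, _ => trivial
  | [a, b], h, hf => hf b (by simp) a (by simp) h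
  | a :: b :: c :: w, ⟨h1, h2, h3⟩, hf =>
    ⟨hf b (by simp) a (by simp) h1, hf b (by simp) c (by simp) h2,
      h3.map fun x hx y hy => hf x (by simp_all) y (by simp_all)⟩

theorem downUpPerms_length {n k : ℕ} {w : List ℕ} (hw : w ∈ downUpPerms n k) : w.length = n := by
  simpa using hw.1.length_eq

theorem downUpPerms_eq_cons {n k : ℕ} (hn : 3 ≤ n) {w : List ℕ} (hw : w ∈ downUpPerms n k) :
    ∃ j c u, w = k :: j :: c :: u := by
  have hlen := downUpPerms_length hw
  match w, hlen, hw with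
  | [], h, _ => simp at h; omega
  | [_], h, _ => simp at h; omega
  | [_, _], h, _ => simp at h; omega
  | x :: j :: c :: u, _, hw =>
    obtain rfl : x = k := by simpa using hw.2.2
    exact ⟨j, c, u, rfl⟩

/-- After the letters a + 1, a the third letter exceeds a, hence is at least a + 2 and relabels to
some j ≥ a; any such j is allowed. -/
theorem bijOn_shrink {m a : ℕ} (hm : 1 ≤ m) (h1 : 1 ≤ a) (ha : a ≤ m + 1) :
    Set.BijOn (fun w : List ℕ => (w.drop 2).map (shrink a))
      {w | w ∈ downUpPerms (m + 2) (a + 1) ∧ w[1]? = some a}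
      {u | ∃ j, a ≤ j ∧ u ∈ downUpPerms m j} := by
  have decomp : ∀ w ∈ {w | w ∈ downUpPerms (m + 2) (a + 1) ∧ w[1]? = some a},
      ∃ c u, w = (a + 1) :: a :: c :: u ∧ a < c ∧ IsDownUp (c :: u) ∧
        (a :: (a + 1) :: c :: u).Perm (List.range' 1 (m + 2)) ∧
        ∀ x ∈ c :: u, x ≠ a ∧ x ≠ a + 1 := by
    rintro w ⟨hw, hw1⟩
    obtain ⟨j, c, u, rfl⟩ := downUpPerms_eq_cons (by omega) hw
    obtain rfl : j = a := by simpa using hw1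
    have hp : (j :: (j + 1) :: c :: u).Perm (List.range' 1 (m + 2)) :=
      (List.Perm.swap _ _ _).trans hw.1
    refine ⟨c, u, rfl, hw.2.1.2.1, hw.2.1.2.2, hp, fun x hx => ?_⟩
    have := (perm_range'_iff.1 hp).1
    rw [List.nodup_cons, List.nodup_cons, List.mem_cons, not_or] at this
    exact ⟨fun h => this.1.2 (h ▸ hx), fun h => this.2.1 (h ▸ hx)⟩
  refine Set.InvOn.bijOn (f' := fun u => (a + 1) :: a :: u.map (expand a)) ⟨?_, ?_⟩ ?_ ?_
  · intro w hw
    obtain ⟨c, u, rfl, -, -, -, hne⟩ := decomp w hw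
    show (a + 1) :: a :: (((c :: u).map (shrink a)).map (expand a)) = _
    rw [list_map_map_eq_self fun x hx => expand_shrink (hne x hx).1 (hne x hx).2]
  · rintro u -
    show (u.map (expand a)).map (shrink a) = u
    exact list_map_map_eq_self fun x _ => shrink_expand a x
  · intro w hw
    obtain ⟨c, u, rfl, hac, hdu, hp, hne⟩ := decomp w hw
    have hc := hne c (by simp)
    refine ⟨shrink a c, ?_, perm_shrink hp,
      hdu.map fun x hx y hy => shrink_lt_shrink (hne x hx) (hne y hy), rfl⟩
    simp only [shrink]; split_ifs <;> omega
  · rintro u ⟨j, haj, hu⟩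
    refine ⟨⟨(List.Perm.swap _ _ _).trans (perm_expand h1 ha hu.1), ?_, rfl⟩, rfl⟩
    have hlen := downUpPerms_length hu
    obtain ⟨-, hdu, hhd⟩ := hu
    match u, hlen, hdu, hhd with
    | [], h, _, _ => simp at h; omega
    | c :: u, _, hdu, hhd =>
      obtain rfl : c = j := by simpa using hhd
      refine ⟨by omega, ?_, hdu.map fun x _ y _ => expand_lt_expand⟩
      simp only [expand]; split_ifs <;> omega

theorem increasingTrees_length {n k : ℕ} {T : BinaryTree ℕ} (hT : T ∈ increasingTrees n k) :
    (inorder T).length = n := by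
  simpa using hT.2.1.length_eq

/-- A minimal leaf j ≥ a expands to j + 2 > a + 1, which is what grafting needs. The same range of j
occurs for the shortened words. -/
theorem bijOn_graft {m a : ℕ} (h1 : 1 ≤ a) (ha : a ≤ m + 1) :
    Set.BijOn (fun T : BinaryTree ℕ => graft (a + 1) (T.map (expand a)))
      {T | ∃ j, a ≤ j ∧ T ∈ increasingTrees m j}
      {T | T ∈ increasingTrees (m + 2) (a + 1) ∧ HasPathEdge a (a + 1) T ∧ IsGrafted a T} := by
  have key : ∀ T j, a ≤ j → T ∈ increasingTrees m j → _ := fun T j haj hT =>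
    graft_spec (a := a) (T := T.map (expand a)) (m := expand a j)
      (hT.1.map fun x _ y _ => expand_lt_expand)
      (by rw [inorder_map, List.mem_map]; rintro ⟨x, -, hx⟩; exact (expand_ne a x).1 hx)
      (by rw [inorder_map, List.mem_map]; rintro ⟨x, -, hx⟩; exact (expand_ne a x).2 hx)
      (by rw [minLeaf_map, hT.2.2]; rfl)
      (by simp only [expand]; split_ifs <;> omega)
  have key' : ∀ T ∈ {T | T ∈ increasingTrees (m + 2) (a + 1) ∧ HasPathEdge a (a + 1) T ∧
      IsGrafted a T}, _ := fun T hT => ungraft_spec hT.1.1 hT.1.2.2 hT.2.1 hT.2.2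
  have hne : ∀ T ∈ {T | T ∈ increasingTrees (m + 2) (a + 1) ∧ HasPathEdge a (a + 1) T ∧
      IsGrafted a T}, (a :: (a + 1) :: inorder (ungraft a T)).Perm (List.range' 1 (m + 2)) ∧
        ∀ x ∈ inorder (ungraft a T), x ≠ a ∧ x ≠ a + 1 := fun T hT => by
    have hp := (key' T hT).2.1.symm.trans hT.1.2.1
    refine ⟨hp, fun x hx => ?_⟩
    have := (perm_range'_iff.1 hp).1
    rw [List.nodup_cons, List.nodup_cons, List.mem_cons, not_or] at this
    exact ⟨fun h => this.1.2 (h ▸ hx), fun h => this.2.1 (h ▸ hx)⟩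
  refine Set.InvOn.bijOn (f' := fun T => (ungraft a T).map (shrink a)) ⟨?_, ?_⟩ ?_ ?_
  · rintro T ⟨j, haj, hT⟩
    simp only [(key T j haj hT).2.2.2.2.2]
    exact map_map_eq_self fun x _ => shrink_expand a x
  · intro T hT
    simp only
    rw [map_map_eq_self fun x hx => expand_shrink ((hne T hT).2 x hx).1 ((hne T hT).2 x hx).2]
    exact (key' T hT).2.2.2
  · rintro T ⟨j, haj, hT⟩
    obtain ⟨g1, g2, g3, g4, g5, -⟩ := key T j haj hT
    refine ⟨⟨g1, g2.trans ?_, g3⟩, g4, g5⟩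
    rw [inorder_map]
    exact perm_expand h1 ha hT.2.1
  · intro T hT
    obtain ⟨hp, hne⟩ := hne T hT
    obtain ⟨g1, g2, ⟨j, g3, g4⟩, -⟩ := key' T hT
    refine ⟨shrink a j, ?_, g1.map fun x hx y hy => shrink_lt_shrink (hne x hx) (hne y hy), ?_, ?_⟩
    · simp only [shrink]; split_ifs; omega
    · rw [inorder_map]; exact perm_shrink hp
    · rw [minLeaf_map, g3]; rfl

theorem isDownUp_map_swap {a x j c : ℕ} {u : List ℕ} (h : IsDownUp (x :: j :: c :: u))
    (hx : x = a ∨ x = a + 1) (hj : j < a) (hne : ∀ y ∈ c :: u, y ≠ x) :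
    IsDownUp ((x :: j :: c :: u).map (Equiv.swap a (a + 1))) := by
  refine ⟨swap_lt_swap h.1 (by omega), swap_lt_swap h.2.1 (by omega),
    h.2.2.map fun y hy z hz hyz => swap_lt_swap hyz ?_⟩
  have := hne y hy
  have := hne z hz
  omega

/-- The only strict inequality destroyed by the exchange is a < a + 1. It is not compared here: the
second letter lies below a, and the later letters avoid the first one. -/
theorem bijOn_map_swap {n a : ℕ} (hn : 3 ≤ n) (h1 : 1 ≤ a) (ha : a + 1 ≤ n) :
    Set.BijOn (List.map (Equiv.swap a (a + 1)))
      {w | w ∈ downUpPerms n (a + 1) ∧ w[1]? ≠ some a} (downUpPerms n a) := by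
  have inv : ∀ w : List ℕ, (w.map (Equiv.swap a (a + 1))).map (Equiv.swap a (a + 1)) = w :=
    fun w => list_map_map_eq_self fun x _ => Equiv.swap_apply_self _ _ _
  have hne : ∀ {k j c : ℕ} {u : List ℕ}, k :: j :: c :: u ∈ downUpPerms n k →
      ∀ y ∈ c :: u, y ≠ k := fun {k j c u} hw y hy h => by
    have := (perm_range'_iff.1 hw.1).1
    rw [List.nodup_cons] at this
    exact this.1 (List.mem_cons_of_mem _ (h ▸ hy))
  refine Set.InvOn.bijOn (f' := List.map (Equiv.swap a (a + 1))) ⟨fun w _ => inv w,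
    fun w _ => inv w⟩ ?_ ?_
  · rintro w ⟨hw, hw1⟩
    obtain ⟨j, c, u, rfl⟩ := downUpPerms_eq_cons hn hw
    simp only [List.getElem?_cons_succ, List.getElem?_cons_zero, ne_eq, Option.some.injEq] at hw1
    have := hw.2.1.1
    exact ⟨perm_swap h1 ha hw.1, isDownUp_map_swap hw.2.1 (.inr rfl) (by omega) (hne hw), by simp⟩
  · intro w hw
    obtain ⟨j, c, u, rfl⟩ := downUpPerms_eq_cons hn hw
    have := hw.2.1.1
    refine ⟨⟨perm_swap h1 ha hw.1, isDownUp_map_swap hw.2.1 (.inl rfl) (by omega) (hne hw),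
      by simp⟩, ?_⟩
    simp only [List.map_cons, List.getElem?_cons_succ, List.getElem?_cons_zero, ne_eq,
      Option.some.injEq]
    rw [Equiv.swap_apply_of_ne_of_ne] <;> omega

theorem bijOn_union_of_disjoint {α β : Type*} {f : α → β} {s₁ s₂ : Set α} {t₁ t₂ : Set β}
    (h₁ : Set.BijOn f s₁ t₁) (h₂ : Set.BijOn f s₂ t₂) (h : Disjoint t₁ t₂) :
    Set.BijOn f (s₁ ∪ s₂) (t₁ ∪ t₂) := by
  refine h₁.union h₂ ?_
  rintro x (hx | hx) y (hy | hy) hxy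
  · exact h₁.injOn hx hy hxy
  · exact (Set.disjoint_left.1 h (h₁.mapsTo hx) (hxy ▸ h₂.mapsTo hy)).elim
  · exact (Set.disjoint_left.1 h (h₁.mapsTo hy) (hxy ▸ h₂.mapsTo hx)).elim
  · exact h₂.injOn hx hy hxy

/-- Siblings a, a + 1 rotate onto the trees in which a is the parent of the leaf a + 1 but is not
grafted; all other trees go by label exchange onto those in which a is not that parent. -/
theorem bijOn_rotateOrSwap {n a : ℕ} (hn : 3 ≤ n) (h1 : 1 ≤ a) (ha : a + 1 ≤ n) :
    Set.BijOn (rotateOrSwap a) (increasingTrees n a)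
      {T | T ∈ increasingTrees n (a + 1) ∧ ¬ (HasPathEdge a (a + 1) T ∧ IsGrafted a T)} := by
  have hnd : ∀ {k : ℕ} {T : BinaryTree ℕ}, T ∈ increasingTrees n k → (inorder T).Nodup :=
    fun hT => (perm_range'_iff.1 hT.2.1).1
  have rot : Set.BijOn (rotateOrSwap a) {T | T ∈ increasingTrees n a ∧ areSiblings a (a + 1) T}
      {T | T ∈ increasingTrees n (a + 1) ∧ HasPathEdge a (a + 1) T ∧ ¬ IsGrafted a T} := by
    have key : ∀ T ∈ {T | T ∈ increasingTrees n a ∧ areSiblings a (a + 1) T}, _ := fun T hT =>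
      rotate_spec hT.1.1 (hnd hT.1) hT.1.2.2 hT.2
    have key' : ∀ T ∈ {T | T ∈ increasingTrees n (a + 1) ∧ HasPathEdge a (a + 1) T ∧
        ¬ IsGrafted a T}, _ := fun T hT =>
      unrotate_spec hT.1.1 (hnd hT.1) hT.1.2.2 hT.2.1 hT.2.2 <| by
        -- A root a that is not grafted has no right child, so the tree would have only the vertices
        -- a and a + 1; n ≥ 3 excludes this.
        obtain ⟨⟨hinc, hp, hm⟩, he, hg⟩ := hT
        have hlen : (inorder T).length = n := by simpa using hp.length_eq
        cases T with
        | nil => simp [rootLabel]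
        | node v l r =>
          simp only [rootLabel, ne_eq, Option.some.injEq]
          rintro rfl
          simp only [IsGrafted, if_true, not_not] at hg
          subst hg
          have hl : rootLabel l = some (v + 1) := by
            rcases he with he | he
            · exact he.2
            · exact ((hinc.lt_of_mem_left he.mem).false).elim
          have hml : minLeaf l = some (v + 1) := by
            rcases minLeaf_node hm with h' | ⟨-, h'⟩
            · exact h'
            · omega
          obtain rfl := eq_leaf_of_rootLabel_of_minLeaf hinc.2.2.2.1 hl hml
          simp [inorder] at hlen
          omega
    have he : Set.EqOn (rotate (a + 1)) (rotateOrSwap a)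
        {T | T ∈ increasingTrees n a ∧ areSiblings a (a + 1) T} := fun T hT => by
      simp [rotateOrSwap, hT.2]
    refine Set.BijOn.congr (Set.InvOn.bijOn (f' := unrotate a) ⟨?_, ?_⟩ ?_ ?_) he
    · exact fun T hT => (key T hT).2.2.2.2.2
    · exact fun T hT => (key' T hT).2.2.2.2
    · intro T hT
      obtain ⟨g1, g2, g3, g4, g5, -⟩ := key T hT
      exact ⟨⟨g1, g2.trans hT.1.2.1, g3⟩, g4, g5⟩
    · intro T hT
      obtain ⟨g1, g2, g3, g4, -⟩ := key' T hT
      exact ⟨⟨g1, g2.trans hT.1.2.1, g3⟩, g4⟩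
  have swp : Set.BijOn (rotateOrSwap a) {T | T ∈ increasingTrees n a ∧ ¬ areSiblings a (a + 1) T}
      {T | T ∈ increasingTrees n (a + 1) ∧ ¬ HasPathEdge a (a + 1) T} := by
    have he : Set.EqOn (BinaryTree.map (Equiv.swap a (a + 1))) (rotateOrSwap a)
        {T | T ∈ increasingTrees n a ∧ ¬ areSiblings a (a + 1) T} := fun T hT => by
      simp only [rotateOrSwap, if_neg hT.2]
    have inv : ∀ T : BinaryTree ℕ,
        (T.map (Equiv.swap a (a + 1))).map (Equiv.swap a (a + 1)) = T :=
      fun T => map_map_eq_self fun x _ => Equiv.swap_apply_self _ _ _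
    refine Set.BijOn.congr (Set.InvOn.bijOn (f' := BinaryTree.map (Equiv.swap a (a + 1)))
      ⟨fun T _ => inv T, fun T _ => inv T⟩ ?_ ?_) he
    · rintro T ⟨hT, hs⟩
      refine ⟨⟨hT.1.map_swap (hnd hT) hT.2.2 (.inl rfl)
        (fun h => h.minLeaf_ne hT.1 hT.2.2) hs, ?_, ?_⟩, fun h => ?_⟩
      · rw [inorder_map]; exact perm_swap h1 ha hT.2.1
      · rw [minLeaf_map, hT.2.2]; simp
      -- An edge from a to a + 1 in the image comes from an edge from a + 1 to a, against increase.
      · have := (hasPathEdge_map_swap.1 h).lt hT.1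
        omega
    · rintro T ⟨hT, he⟩
      refine ⟨⟨hT.1.map_swap (hnd hT) hT.2.2 (.inr rfl) he
        (not_areSiblings_of_minLeaf (hnd hT) hT.1 hT.2.2), ?_, ?_⟩, fun h => ?_⟩
      · rw [inorder_map]; exact perm_swap h1 ha hT.2.1
      · rw [minLeaf_map, hT.2.2]; simp
      · have := lt_of_areSiblings (areSiblings_map_swap.1 h) hT.1
        omega
  have hU := bijOn_union_of_disjoint rot swp
    (Set.disjoint_left.2 fun T hT hT' => hT'.2 hT.2.1)
  convert hU using 1
  · ext T; simp only [Set.mem_union, Set.mem_ofPred_eq]; tauto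
  · ext T; simp only [Set.mem_union, Set.mem_ofPred_eq]; tauto

theorem psi_of_second_eq {a c : ℕ} {u : List ℕ} :
    psi ((a + 1) :: a :: c :: u) =
      graft (a + 1) ((psi ((c :: u).map (shrink a))).map (expand a)) := by
  rw [psi, if_pos rfl]
  rfl

theorem psi_of_second_lt {a j c : ℕ} {u : List ℕ} (h : j < a) :
    psi ((a + 1) :: j :: c :: u) =
      rotateOrSwap a (psi (((a + 1) :: j :: c :: u).map (Equiv.swap a (a + 1)))) := by
  rw [psi, if_neg (by omega), if_pos (by omega)]
  rfl

theorem downUpPerms_eq_empty {n k : ℕ} (h : k = 0 ∨ n < k) : downUpPerms n k = ∅ := by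
  refine Set.eq_empty_of_forall_notMem fun w hw => ?_
  have := (perm_range'_iff.1 hw.1).2 k |>.1 (List.mem_of_head? hw.2.2)
  omega

theorem increasingTrees_eq_empty {n k : ℕ} (h : k = 0 ∨ n < k) : increasingTrees n k = ∅ := by
  refine Set.eq_empty_of_forall_notMem fun w hw => ?_
  have := (perm_range'_iff.1 hw.2.1).2 k |>.1 (mem_inorder_of_minLeaf hw.2.2)
  omega

theorem downUpPerms_one_eq_empty {n : ℕ} (hn : 2 ≤ n) : downUpPerms n 1 = ∅ := by
  refine Set.eq_empty_of_forall_notMem fun w hw => ?_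
  have hlen := downUpPerms_length hw
  match w, hlen, hw with
  | [], h, _ => simp at h; omega
  | [_], h, _ => simp at h; omega
  | x :: j :: u, _, hw =>
    obtain rfl : x = 1 := by simpa using hw.2.2
    have hj : j < 1 := by
      cases u with
      | nil => exact hw.2.1
      | cons c u => exact hw.2.1.1
    have := (perm_range'_iff.1 hw.1).2 j |>.1 (by simp)
    omega

theorem increasingTrees_one_eq_empty {n : ℕ} (hn : 2 ≤ n) : increasingTrees n 1 = ∅ := by
  refine Set.eq_empty_of_forall_notMem fun T hT => ?_
  have hlen := increasingTrees_length hT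
  cases h : rootLabel T with
  | none => rw [rootLabel_eq_none.1 h] at hlen; simp [inorder] at hlen; omega
  | some r =>
    have h1 := hT.1.rootLabel_le h 1 (mem_inorder_of_minLeaf hT.2.2)
    have h2 := (perm_range'_iff.1 hT.2.1).2 r |>.1 (mem_inorder_of_rootLabel h)
    obtain rfl : r = 1 := by omega
    rw [eq_leaf_of_rootLabel_of_minLeaf hT.1 h hT.2.2] at hlen
    simp [inorder] at hlen; omega

theorem eq_of_head?_of_le_two {n : ℕ} (hn : 1 ≤ n) (hn' : n ≤ 2) {w : List ℕ}
    (hw : w.Perm (List.range' 1 n)) (hh : w.head? = some n) : w = (List.range' 1 n).reverse := by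
  have hlen := hw.length_eq
  obtain rfl | rfl : n = 1 ∨ n = 2 := by omega
  · match w, hlen, hh with
    | [x], _, hh => simpa using hh
  · match w, hlen, hh, hw with
    | [x, y], _, hh, hw =>
      obtain rfl : x = 2 := by simpa using hh
      have := (hw.mem_iff (a := 1)).2 (by simp)
      obtain rfl : y = 1 := by simpa [eq_comm] using this
      rfl

theorem psi_bijOn_of_le_two {n : ℕ} (hn : 1 ≤ n) (hn' : n ≤ 2) :
    Set.BijOn psi (downUpPerms n n) (increasingTrees n n) := by
  have h1 : (List.range' 1 n).reverse ∈ downUpPerms n n := by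
    refine ⟨List.reverse_perm _, ?_, ?_⟩ <;>
      obtain rfl | rfl : n = 1 ∨ n = 2 := by omega
    all_goals simp [List.range', IsDownUp]
  have h2 : psi (List.range' 1 n).reverse ∈ increasingTrees n n ∧
      inorder (psi (List.range' 1 n).reverse) = (List.range' 1 n).reverse := by
    obtain rfl | rfl : n = 1 ∨ n = 2 := by omega
    · simp [List.range', psi, increasingTrees, inorder, IsIncreasing, minLeaf, rootLabel]
    · simp [List.range', psi, increasingTrees, inorder, IsIncreasing, minLeaf, rootLabel,
        List.Perm.swap]
  have hs : downUpPerms n n = {(List.range' 1 n).reverse} :=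
    Set.eq_singleton_iff_unique_mem.2
      ⟨h1, fun w hw => eq_of_head?_of_le_two hn hn' hw.1 hw.2.2⟩
  have ht : increasingTrees n n = {psi (List.range' 1 n).reverse} := by
    refine Set.eq_singleton_iff_unique_mem.2 ⟨h2.1, fun T hT => ?_⟩
    refine hT.1.eq_of_inorder_eq h2.1.1 (perm_range'_iff.1 hT.2.1).1 ?_
    rw [h2.2, eq_of_head?_of_le_two hn hn' hT.2.1 ((head?_inorder T).trans hT.2.2)]
  rw [hs, ht]
  exact Set.bijOn_singleton.2 rfl

/-- Words with different first entries have different images, since the minimal leaf recovers the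
first entry. -/
theorem psi_bijOn_union {m a : ℕ}
    (h : ∀ j, Set.BijOn psi (downUpPerms m j) (increasingTrees m j)) :
    Set.BijOn psi {u | ∃ j, a ≤ j ∧ u ∈ downUpPerms m j}
      {T | ∃ j, a ≤ j ∧ T ∈ increasingTrees m j} := by
  refine ⟨?_, ?_, ?_⟩
  · rintro u ⟨j, hj, hu⟩
    exact ⟨j, hj, (h j).mapsTo hu⟩
  · rintro u ⟨j, hj, hu⟩ u' ⟨j', hj', hu'⟩ he
    have h1 := ((h j).mapsTo hu).2.2
    rw [he, ((h j').mapsTo hu').2.2, Option.some.injEq] at h1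
    subst h1
    exact (h j').injOn hu hu' he
  · rintro T ⟨j, hj, hT⟩
    obtain ⟨u, hu, rfl⟩ := (h j).surjOn hT
    exact ⟨u, ⟨j, hj, hu⟩, rfl⟩

/-- The map `psi` is a bijection from down-up permutations to increasing 1-2 trees that takes the
first entry to the minimal leaf. -/
theorem psi_bijOn (n k : ℕ) : Set.BijOn psi (downUpPerms n k) (increasingTrees n k) := by
  induction n using Nat.strong_induction_on generalizing k with
  | _ n ihn =>
  induction k with
  | zero =>
    rw [downUpPerms_eq_empty (.inl rfl), increasingTrees_eq_empty (.inl rfl)]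
    exact Set.bijOn_empty _
  | succ a iha =>
    by_cases han : n < a + 1
    · rw [downUpPerms_eq_empty (.inr han), increasingTrees_eq_empty (.inr han)]
      exact Set.bijOn_empty _
    rcases Nat.eq_zero_or_pos a with rfl | ha
    · by_cases hn : 2 ≤ n
      · rw [downUpPerms_one_eq_empty hn, increasingTrees_one_eq_empty hn]
        exact Set.bijOn_empty _
      · obtain rfl : n = 1 := by omega
        exact psi_bijOn_of_le_two le_rfl (by omega)
    by_cases hn : n ≤ 2
    · obtain rfl : n = 2 := by omega
      obtain rfl : a = 1 := by omega
      exact psi_bijOn_of_le_two (by omega) le_rfl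
    obtain ⟨m, rfl⟩ : ∃ m, n = m + 2 := ⟨n - 2, by omega⟩
    -- Second entry a: delete two letters, apply the induction on n, graft.
    have first := (bijOn_graft ha (by omega)).comp
      ((psi_bijOn_union (a := a) (ihn m (by omega))).comp
        (bijOn_shrink (by omega) ha (by omega)))
    -- Second entry below a: pass to first entry a, apply the induction on a, then rotate or
    -- exchange.
    have second := (bijOn_rotateOrSwap (by omega) ha (by omega)).comp
      (iha.comp (bijOn_map_swap (n := m + 2) (by omega) ha (by omega)))
    have hU := bijOn_union_of_disjoint
      (first.congr (f₂ := psi) fun w hw => ?_) (second.congr (f₂ := psi) fun w hw => ?_)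
      (Set.disjoint_left.2 fun T hT hT' => hT'.2 hT.2)
    · convert hU using 1
      · ext w; simp only [Set.mem_union, Set.mem_ofPred_eq]; tauto
      · ext w; simp only [Set.mem_union, Set.mem_ofPred_eq]; tauto
    · obtain ⟨hw, hw1⟩ := hw
      obtain ⟨j, c, u, rfl⟩ := downUpPerms_eq_cons (by omega) hw
      obtain rfl : j = a := by simpa using hw1
      exact psi_of_second_eq.symm
    · obtain ⟨hw, hw1⟩ := hw
      obtain ⟨j, c, u, rfl⟩ := downUpPerms_eq_cons (by omega) hw
      have := hw.2.1.1
      simp only [List.getElem?_cons_succ, List.getElem?_cons_zero, ne_eq, Option.some.injEq] at hw1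
      exact (psi_of_second_lt (by omega)).symm

end StandardLabels

/-! ### Transfer to signed labels through ranks -/

section Relabeling

theorem rank_lt_rank {V : Finset ℤ} {x y : ℤ} (hy : y ∈ V) (h : x < y) : rank V x < rank V y := by
  refine Finset.card_lt_card ⟨fun z hz => ?_, fun hsub => ?_⟩
  · simp only [Finset.mem_filter] at hz ⊢
    exact ⟨hz.1, hz.2.trans h.le⟩
  · have := hsub (Finset.mem_filter.2 ⟨hy, le_rfl⟩)
    simp only [Finset.mem_filter] at this
    omega

theorem one_le_rank {V : Finset ℤ} {x : ℤ} (hx : x ∈ V) : 1 ≤ rank V x :=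
  Finset.card_pos.2 ⟨x, Finset.mem_filter.2 ⟨hx, le_rfl⟩⟩

theorem rank_le_card (V : Finset ℤ) (x : ℤ) : rank V x ≤ V.card :=
  Finset.card_filter_le _ _

theorem rank_injOn {V : Finset ℤ} : Set.InjOn (rank V) V := by
  intro x hx y hy h
  rcases lt_trichotomy x y with hxy | rfl | hxy
  · exact absurd h (rank_lt_rank hy hxy).ne
  · rfl
  · exact absurd h (rank_lt_rank hx hxy).ne'

theorem unrank_eq_getElem {V : Finset ℤ} {i : ℕ} (h1 : 1 ≤ i) (h2 : i ≤ V.card) :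
    unrank V i = (V.sort (· ≤ ·))[i - 1]'(by rw [Finset.length_sort]; omega) :=
  List.getD_eq_getElem _ _ _

theorem unrank_mem {V : Finset ℤ} {i : ℕ} (h1 : 1 ≤ i) (h2 : i ≤ V.card) : unrank V i ∈ V := by
  rw [unrank_eq_getElem h1 h2, ← Finset.mem_sort (· ≤ ·)]
  exact List.getElem_mem _

theorem unrank_lt_unrank {V : Finset ℤ} {i j : ℕ} (h1 : 1 ≤ i) (h : i < j) (h2 : j ≤ V.card) :
    unrank V i < unrank V j := by
  rw [unrank_eq_getElem h1 (by omega), unrank_eq_getElem (by omega) h2]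
  exact (Finset.sortedLT_sort V).pairwise.rel_get_of_lt (a := ⟨i - 1, _⟩) (b := ⟨j - 1, _⟩)
    (by simp only [Fin.mk_lt_mk]; omega)

/-- Each step raises g by at least 1; counting up from 1 gives i ≤ g i, and counting on to c gives g
i ≤ i. -/
theorem eq_self_of_strictMono_Icc {g : ℕ → ℕ} {c : ℕ}
    (hg : ∀ i j, 1 ≤ i → i < j → j ≤ c → g i < g j)
    (hr : ∀ i, 1 ≤ i → i ≤ c → 1 ≤ g i ∧ g i ≤ c) {i : ℕ} (h1 : 1 ≤ i) (h2 : i ≤ c) : g i = i := by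
  have key : ∀ d i, 1 ≤ i → i + d ≤ c → g i + d ≤ g (i + d) := by
    intro d
    induction d with
    | zero => intros; rfl
    | succ d ih =>
      intro i hi hd
      have := ih i hi (by omega)
      have := hg (i + d) (i + (d + 1)) (by omega) (by omega) hd
      omega
  have e1 := key (i - 1) 1 le_rfl (by omega)
  have e2 := key (c - i) i h1 (by omega)
  rw [show 1 + (i - 1) = i by omega] at e1
  rw [show i + (c - i) = c by omega] at e2
  have := hr 1 le_rfl (by omega)
  have := hr c (by omega) le_rfl
  omega

theorem rank_unrank {V : Finset ℤ} {i : ℕ} (h1 : 1 ≤ i) (h2 : i ≤ V.card) :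
    rank V (unrank V i) = i :=
  eq_self_of_strictMono_Icc (g := fun i => rank V (unrank V i))
    (fun i j hi hij hj => rank_lt_rank (unrank_mem (by omega) hj) (unrank_lt_unrank hi hij hj))
    (fun _ hi hc => ⟨one_le_rank (unrank_mem hi hc), rank_le_card _ _⟩) h1 h2

theorem unrank_rank {V : Finset ℤ} {x : ℤ} (hx : x ∈ V) : unrank V (rank V x) = x :=
  rank_injOn (unrank_mem (one_le_rank hx) (rank_le_card V x)) hx
    (rank_unrank (one_le_rank hx) (rank_le_card V x))

theorem perm_range'_of_nodup {n : ℕ} {w : List ℕ} (hn : w.Nodup) (hlen : w.length = n)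
    (hr : ∀ x ∈ w, 1 ≤ x ∧ x ≤ n) : w.Perm (List.range' 1 n) := by
  refine (List.subperm_of_subset hn fun x hx => ?_).perm_of_length_le (by simp [hlen])
  rw [List.mem_range'_1]
  have := hr x hx
  omega

theorem IsSignedPerm.nodup {n : ℕ} {w : List ℤ} (hw : IsSignedPerm n w) : w.Nodup :=
  List.Nodup.of_map _ (hw.nodup_iff.2 List.nodup_range')

theorem IsSignedPerm.length_eq {n : ℕ} {w : List ℤ} (hw : IsSignedPerm n w) : w.length = n := by
  simpa using List.Perm.length_eq hw

theorem IsSignedPerm.perm {n : ℕ} {w w' : List ℤ} (hw : IsSignedPerm n w) (h : w'.Perm w) :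
    IsSignedPerm n w' :=
  (h.map _).trans hw

theorem IsSignedPerm.card_toFinset {n : ℕ} {w : List ℤ} (hw : IsSignedPerm n w) :
    w.toFinset.card = n :=
  (List.toFinset_card_of_nodup hw.nodup).trans hw.length_eq

theorem IsSignedPerm.map_rank_perm {n : ℕ} {w : List ℤ} (hw : IsSignedPerm n w) :
    (w.map (rank w.toFinset)).Perm (List.range' 1 n) := by
  refine perm_range'_of_nodup (hw.nodup.map_on fun x hx y hy h =>
    rank_injOn (by simpa using hx) (by simpa using hy) h) (by simpa using hw.length_eq) ?_
  intro i hi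
  obtain ⟨x, hx, rfl⟩ := List.mem_map.1 hi
  exact ⟨one_le_rank (by simpa using hx), (rank_le_card _ _).trans hw.card_toFinset.le⟩

theorem map_unrank_map_rank {w : List ℤ} {V : Finset ℤ} (h : ∀ x ∈ w, x ∈ V) :
    (w.map (rank V)).map (unrank V) = w :=
  list_map_map_eq_self fun x hx => unrank_rank (h x hx)

theorem map_rank_map_unrank {u : List ℕ} {V : Finset ℤ} (h : u.Perm (List.range' 1 V.card)) :
    (u.map (unrank V)).map (rank V) = u :=
  list_map_map_eq_self fun x hx =>
    rank_unrank (((perm_range'_iff.1 h).2 x).1 hx).1 (((perm_range'_iff.1 h).2 x).1 hx).2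

theorem unrank_lt_unrank_of_perm {u : List ℕ} {V : Finset ℤ} (h : u.Perm (List.range' 1 V.card)) :
    ∀ x ∈ u, ∀ y ∈ u, x < y → unrank V x < unrank V y := fun x hx y hy hxy =>
  unrank_lt_unrank (((perm_range'_iff.1 h).2 x).1 hx).1 hxy (((perm_range'_iff.1 h).2 y).1 hy).2

theorem map_rank_mem_downUpPerms {n : ℕ} {k : ℤ} {w : List ℤ} (hw : w ∈ snakesB n k) :
    w.map (rank w.toFinset) ∈ downUpPerms n (rank w.toFinset k) := by
  obtain ⟨h1, h2, h3⟩ := hw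
  exact ⟨h1.map_rank_perm, h2.map fun x _ y hy => rank_lt_rank (by simpa using hy), by simp [h3]⟩

theorem map_rank_mem_increasingTrees {n : ℕ} {k : ℤ} {T : BinaryTree ℤ} (hT : T ∈ treesB n k) :
    T.map (rank (inorder T).toFinset) ∈ increasingTrees n (rank (inorder T).toFinset k) := by
  obtain ⟨h1, h2, h3⟩ := hT
  refine ⟨h1.map fun x _ y hy => rank_lt_rank (by simpa using hy), ?_, ?_⟩
  · rw [inorder_map]; exact h2.map_rank_perm
  · rw [minLeaf_map, h3]; rfl

theorem inorder_psiB_perm {n : ℕ} {k : ℤ} {w : List ℤ} (hw : w ∈ snakesB n k) :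
    (inorder (psiB w)).Perm w := by
  have hT := (psi_bijOn n _).mapsTo (map_rank_mem_downUpPerms hw)
  rw [psiB, inorder_map]
  refine ((hT.2.1.trans hw.1.map_rank_perm.symm).map _).trans ?_
  rw [map_unrank_map_rank fun x hx => by simpa using hx]

theorem psiB_bijOn (n : ℕ) (k : ℤ) : Set.BijOn psiB (snakesB n k) (treesB n k) := by
  refine ⟨?_, ?_, ?_⟩
  · intro w hw
    have hT := (psi_bijOn n _).mapsTo (map_rank_mem_downUpPerms hw)
    refine ⟨hT.1.map (unrank_lt_unrank_of_perm (by rw [hw.1.card_toFinset]; exact hT.2.1)),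
      hw.1.perm (inorder_psiB_perm hw), ?_⟩
    rw [psiB, minLeaf_map, hT.2.2, Option.map_some, unrank_rank]
    simpa using List.mem_of_head? hw.2.2
  · intro w hw w' hw' h
    -- The image tree has the entries of the word as labels, so equal images share one relabelling,
    -- which can be cancelled.
    have hV : w.toFinset = w'.toFinset := List.toFinset_eq_of_perm _ _
      ((inorder_psiB_perm hw).symm.trans (h ▸ inorder_psiB_perm hw'))
    have hu := map_rank_mem_downUpPerms hw
    have hu' := map_rank_mem_downUpPerms hw'
    have hT := (psi_bijOn n _).mapsTo hu
    have hT' := (psi_bijOn n _).mapsTo hu'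
    have key : ∀ {T : BinaryTree ℕ} {j : ℕ}, T ∈ increasingTrees n j →
        (T.map (unrank w.toFinset)).map (rank w.toFinset) = T := fun {T j} hT =>
      map_map_eq_self fun i hi => by
        have := ((perm_range'_iff.1 hT.2.1).2 i).1 hi
        exact rank_unrank this.1 (hw.1.card_toFinset ▸ this.2)
    rw [psiB, psiB] at h
    rw [← hV] at hu' hT' h
    have h2 := congrArg (BinaryTree.map (rank w.toFinset)) h
    rw [key hT, key hT'] at h2
    have h3 := congrArg (List.map (unrank w.toFinset)) ((psi_bijOn n _).injOn hu hu' h2)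
    rwa [map_unrank_map_rank fun x hx => by simpa using hx,
      map_unrank_map_rank fun x hx => by simpa [hV] using hx] at h3
  · intro T hT
    obtain ⟨u, hu, hpsi⟩ := (psi_bijOn n _).surjOn (map_rank_mem_increasingTrees hT)
    set V := (inorder T).toFinset with hVdef
    have hk : k ∈ V := by simpa [V] using mem_inorder_of_minLeaf hT.2.2
    have hcard : V.card = n := hT.2.1.card_toFinset
    have huV : u.Perm (List.range' 1 V.card) := by rw [hcard]; exact hu.1
    have hperm : (u.map (unrank V)).Perm (inorder T) := by
      refine ((hu.1.trans hT.2.1.map_rank_perm.symm).map (unrank V)).trans ?_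
      rw [map_unrank_map_rank fun x hx => by simpa [V] using hx]
    have hV : (u.map (unrank V)).toFinset = V := List.toFinset_eq_of_perm _ _ hperm
    refine ⟨u.map (unrank V), ⟨hT.2.1.perm hperm, hu.2.1.map (unrank_lt_unrank_of_perm huV), ?_⟩, ?_⟩
    · rw [List.head?_map, hu.2.2, Option.map_some, unrank_rank hk]
    · rw [psiB, hV, map_rank_map_unrank huV, hpsi]
      exact map_map_eq_self fun x hx => unrank_rank (by simpa [V] using hx)

/-- Reading commutes with relabelling, so the two relabellings cancel. -/
theorem omegaB_eq_reverse_inorder (T : BinaryTree ℤ) : omegaB T = (inorder T).reverse := by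
  rw [omegaB, omega, inorder_map, ← List.map_reverse]
  exact map_unrank_map_rank fun x hx => by simpa using hx

theorem omegaB_bijOn (n : ℕ) (k : ℤ) : Set.BijOn omegaB (treesB n k) (andreB n k) := by
  refine ⟨?_, ?_, ?_⟩
  · rintro T ⟨h1, h2, h3⟩
    rw [omegaB_eq_reverse_inorder]
    have hp := h2.perm (List.reverse_perm (inorder T))
    refine ⟨hp, ?_, ?_⟩
    · rw [← hp.length_eq]
      exact (isAndre_iff_smallest _).1 h1.isAndre
    · rw [List.getLast?_reverse, head?_inorder, h3]
  · intro T hT T' hT' h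
    rw [omegaB_eq_reverse_inorder, omegaB_eq_reverse_inorder, List.reverse_inj] at h
    exact hT.1.eq_of_inorder_eq hT'.1 hT.2.1.nodup h
  · rintro w ⟨h1, h2, h3⟩
    rw [← h1.length_eq] at h2
    obtain ⟨T, hT, rfl⟩ := ((isAndre_iff_smallest w).2 h2).exists_tree h1.nodup
    refine ⟨T, ⟨hT, h1.perm (List.reverse_perm _).symm, ?_⟩, omegaB_eq_reverse_inorder T⟩
    rw [← head?_inorder, ← List.getLast?_reverse, h3]

end Relabeling

/-! ### The Arnold recurrence for snakes -/

section Counting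

/-- Exchange `k` with `k - 1` and `-k` with `-(k - 1)`. -/
def swapAbs (k x : ℤ) : ℤ :=
  if x = k then k - 1 else if x = k - 1 then k else if x = -k then 1 - k
  else if x = 1 - k then -k else x

/-- Exchange `1` and `-1`. -/
def flipOne (x : ℤ) : ℤ := if x = 1 then -1 else if x = -1 then 1 else x

/-- The odd order-preserving map from the complement of `{c, -c}` that lowers the absolute values
above `c` by one. -/
def shrinkAbs (c x : ℤ) : ℤ := if c < x then x - 1 else if x < -c then x + 1 else x

/-- The inverse of `shrinkAbs c`. -/
def expandAbs (c x : ℤ) : ℤ := if c ≤ x then x + 1 else if x ≤ -c then x - 1 else x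

theorem isSignedPerm_iff {n : ℕ} {w : List ℤ} : IsSignedPerm n w ↔
    (w.map Int.natAbs).Nodup ∧ w.length = n ∧ ∀ x ∈ w, 1 ≤ x.natAbs ∧ x.natAbs ≤ n := by
  constructor
  · intro h
    have h' := perm_range'_iff.1 h
    exact ⟨h'.1, h.length_eq, fun x hx => (h'.2 _).1 (List.mem_map_of_mem hx)⟩
  · rintro ⟨h1, h2, h3⟩
    refine perm_range'_of_nodup h1 (by simpa using h2) fun i hi => ?_
    obtain ⟨x, hx, rfl⟩ := List.mem_map.1 hi
    exact h3 x hx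

theorem IsSignedPerm.map {n : ℕ} {w : List ℤ} (hw : IsSignedPerm n w) {f : ℤ → ℤ}
    (hf : ∀ x y, (f x).natAbs = (f y).natAbs → x.natAbs = y.natAbs)
    (hr : ∀ x, 1 ≤ x.natAbs → x.natAbs ≤ n → 1 ≤ (f x).natAbs ∧ (f x).natAbs ≤ n) :
    IsSignedPerm n (w.map f) := by
  rw [isSignedPerm_iff] at hw ⊢
  obtain ⟨h1, h2, h3⟩ := hw
  refine ⟨?_, by simpa using h2, fun y hy => ?_⟩
  · simp only [List.Nodup, List.pairwise_map] at h1 ⊢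
    exact h1.imp fun h h' => h (hf _ _ h')
  · obtain ⟨x, hx, rfl⟩ := List.mem_map.1 hy
    exact hr x (h3 x hx).1 (h3 x hx).2

/-- Negation reverses all inequalities, so the up-down tail becomes down-up; this is the source of
the sign changes in the recurrence. -/
theorem isDownUp_cons_cons {a b : ℤ} {w : List ℤ} :
    IsDownUp (a :: b :: w) ↔ b < a ∧ IsDownUp ((b :: w).map Neg.neg) := by
  induction hlen : w.length generalizing a b w with
  | zero =>
    obtain rfl := List.length_eq_zero_iff.1 hlen
    simp [IsDownUp]
  | succ m ih =>
    obtain ⟨c, w, rfl⟩ := List.exists_cons_of_length_eq_add_one hlen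
    simp only [List.length_cons, add_left_inj] at hlen
    have := ih (a := -b) (b := -c) (w := w.map Neg.neg) (by simpa using hlen)
    rw [isDownUp_cons_cons_cons, List.map_cons, List.map_cons, this, List.map_cons,
      list_map_map_eq_self fun x _ => neg_neg x]
    simp

theorem snakesB_eq_cons {n : ℕ} {k : ℤ} (hn : 2 ≤ n) {w : List ℤ} (hw : w ∈ snakesB n k) :
    ∃ j u, w = k :: j :: u ∧ j < k ∧ ∀ x ∈ j :: u, x.natAbs ≠ k.natAbs := by
  have hlen := hw.1.length_eq
  match w, hlen, hw with
  | [], h, _ => simp at h; omega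
  | [_], h, _ => simp at h; omega
  | x :: j :: u, _, hw =>
    obtain rfl : x = k := by simpa using hw.2.2
    refine ⟨j, u, rfl, (isDownUp_cons_cons.1 hw.2.1).1, fun y hy h => ?_⟩
    have := (isSignedPerm_iff.1 hw.1).1
    rw [List.map_cons, List.nodup_cons] at this
    exact this.1 (h ▸ List.mem_map_of_mem hy)

/-- Only the first letter has absolute value |k|. Thus f need only be increasing away from ±k, apart
from the single comparison of the first two letters. -/
theorem map_mem_snakesB {n : ℕ} {k : ℤ} {w : List ℤ} (hn : 2 ≤ n) (hw : w ∈ snakesB n k)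
    {f : ℤ → ℤ} (hf : ∀ x y, (f x).natAbs = (f y).natAbs → x.natAbs = y.natAbs)
    (hr : ∀ x, 1 ≤ x.natAbs → x.natAbs ≤ n → 1 ≤ (f x).natAbs ∧ (f x).natAbs ≤ n)
    (hmono : ∀ x y, x.natAbs ≠ k.natAbs → y.natAbs ≠ k.natAbs → x < y → f x < f y)
    (hj : ∀ j, w[1]? = some j → j.natAbs ≠ k.natAbs → j < k → f j < f k) :
    w.map f ∈ snakesB n (f k) := by
  obtain ⟨j, u, rfl, hjk, hne⟩ := snakesB_eq_cons hn hw
  have hjk' := hj j rfl (hne j (by simp)) hjk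
  refine ⟨hw.1.map hf hr, ?_, rfl⟩
  cases u with
  | nil => exact hjk'
  | cons c u =>
    obtain ⟨-, h2, h3⟩ := hw.2.1
    exact ⟨hjk', hmono _ _ (hne _ (by simp)) (hne _ (by simp)) h2,
      h3.map fun x hx y hy => hmono _ _ (hne _ (.tail _ hx)) (hne _ (.tail _ hy))⟩

theorem natAbs_swapAbs {k x y : ℤ} (h : (swapAbs k x).natAbs = (swapAbs k y).natAbs) :
    x.natAbs = y.natAbs := by
  simp only [swapAbs] at h; split_ifs at h <;> omega

theorem swapAbs_swapAbs {k : ℤ} (h0 : k ≠ 0) (h1 : k ≠ 1) (x : ℤ) : swapAbs k (swapAbs k x) = x := by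
  grind [swapAbs]

theorem bijOn_swapAbs {n : ℕ} {k : ℤ} (hn : 2 ≤ n) (h0 : k ≠ 0) (h1 : k ≠ 1)
    (hk : k.natAbs ≤ n) (hk' : (k - 1).natAbs ≤ n) :
    Set.BijOn (List.map (swapAbs k)) {w | w ∈ snakesB n k ∧ w[1]? ≠ some (k - 1)}
      (snakesB n (k - 1)) := by
  have inv : ∀ w : List ℤ, (w.map (swapAbs k)).map (swapAbs k) = w := fun w =>
    list_map_map_eq_self fun x _ => swapAbs_swapAbs h0 h1 x
  have hr : ∀ x : ℤ, 1 ≤ x.natAbs → x.natAbs ≤ n →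
      1 ≤ (swapAbs k x).natAbs ∧ (swapAbs k x).natAbs ≤ n := fun x hx hx' => by
    simp only [swapAbs]; split_ifs <;> omega
  have e1 : swapAbs k k = k - 1 := by simp [swapAbs]
  have e2 : swapAbs k (k - 1) = k := by simp [swapAbs]
  refine Set.InvOn.bijOn (f' := List.map (swapAbs k)) ⟨fun w _ => inv w, fun w _ => inv w⟩ ?_ ?_
  · rintro w ⟨hw, hw1⟩
    have := map_mem_snakesB hn hw (f := swapAbs k) (fun x y => natAbs_swapAbs) hr
      (fun x y hx hy hxy => by simp only [swapAbs]; split_ifs <;> omega)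
      -- The second letter is below k and is not k - 1, so it stays below the new first letter k -
      -- 1.
      (fun j hj hjk hjk' => by
        have : j ≠ k - 1 := fun h => hw1 (h ▸ hj)
        rw [e1]
        simp only [swapAbs]; split_ifs <;> omega)
    rwa [e1] at this
  · intro w hw
    have := map_mem_snakesB hn hw (f := swapAbs k) (fun x y => natAbs_swapAbs) hr
      (fun x y hx hy hxy => by simp only [swapAbs]; split_ifs <;> omega)
      (fun j hj hjk hjk' => by rw [e2]; simp only [swapAbs]; split_ifs <;> omega)
    rw [e2] at this
    refine ⟨this, ?_⟩
    obtain ⟨j, u, rfl, hjk, hne⟩ := snakesB_eq_cons hn hw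
    have := hne j (by simp)
    simp only [List.map_cons, List.getElem?_cons_succ, List.getElem?_cons_zero, ne_eq,
      Option.some.injEq, swapAbs]
    split_ifs <;> omega

theorem bijOn_flipOne {n : ℕ} (hn : 2 ≤ n) :
    Set.BijOn (List.map flipOne) (snakesB n 1) (snakesB n (-1)) := by
  have inv : ∀ w : List ℤ, (w.map flipOne).map flipOne = w := fun w =>
    list_map_map_eq_self fun x _ => by grind [flipOne]
  have hf : ∀ x y : ℤ, (flipOne x).natAbs = (flipOne y).natAbs → x.natAbs = y.natAbs :=
    fun x y h => by simp only [flipOne] at h; split_ifs at h <;> omega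
  have hr : ∀ x : ℤ, 1 ≤ x.natAbs → x.natAbs ≤ n →
      1 ≤ (flipOne x).natAbs ∧ (flipOne x).natAbs ≤ n := fun x hx hx' => by
    simp only [flipOne]; split_ifs <;> omega
  refine Set.InvOn.bijOn (f' := List.map flipOne) ⟨fun w _ => inv w, fun w _ => inv w⟩ ?_ ?_
  · intro w hw
    -- The second letter is below 1, nonzero and not -1, hence below -1.
    have hnz : ∀ j, w[1]? = some j → 1 ≤ j.natAbs := fun j hj =>
      ((isSignedPerm_iff.1 hw.1).2.2 j (List.mem_of_getElem? hj)).1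
    exact map_mem_snakesB hn hw (f := flipOne) hf hr
      (fun x y hx hy hxy => by simp only [flipOne]; split_ifs <;> omega)
      (fun j hj hjk hjk' => by
        have := hnz j hj
        simp only [flipOne]; split_ifs <;> omega)
  · intro w hw
    exact map_mem_snakesB hn hw (f := flipOne) hf hr
      (fun x y hx hy hxy => by simp only [flipOne]; split_ifs <;> omega)
      (fun j hj hjk hjk' => by simp only [flipOne]; split_ifs <;> omega)

theorem shrinkAbs_expandAbs {c : ℤ} (x : ℤ) : shrinkAbs c (expandAbs c x) = x := by
  simp only [shrinkAbs, expandAbs]; split_ifs <;> omega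

theorem expandAbs_shrinkAbs {c x : ℤ} (hc : 0 < c) (h : x.natAbs ≠ c.natAbs) :
    expandAbs c (shrinkAbs c x) = x := by
  simp only [shrinkAbs, expandAbs]; split_ifs <;> omega

theorem shrinkAbs_lt {c x y : ℤ} (hc : 0 < c) (hx : x.natAbs ≠ c.natAbs)
    (hy : y.natAbs ≠ c.natAbs) (h : x < y) : shrinkAbs c x < shrinkAbs c y := by
  simp only [shrinkAbs]; split_ifs <;> omega

theorem expandAbs_lt {c x y : ℤ} (h : x < y) : expandAbs c x < expandAbs c y := by
  simp only [expandAbs]; split_ifs <;> omega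

/-- Delete k, negate, and close the gap left at absolute value c = |k|. The new first entry is -k +
1 for k > 0 and -k for k < 0, the two indices in the recurrence. -/
theorem bijOn_shrinkAbs {n : ℕ} {k c : ℤ} (hn : 1 ≤ n) (hc : 0 < c) (hck : c.natAbs = k.natAbs)
    (hk : k.natAbs ≤ n + 1) (hk' : k ≠ 1) :
    Set.BijOn (fun w : List ℤ => ((w.drop 1).map Neg.neg).map (shrinkAbs c))
      {w | w ∈ snakesB (n + 1) k ∧ w[1]? = some (k - 1)}
      (snakesB n (shrinkAbs c (-(k - 1)))) := by
  have hnegne : ∀ {u : List ℤ}, (∀ x ∈ u, x.natAbs ≠ k.natAbs) →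
      ∀ x ∈ u.map Neg.neg, x.natAbs ≠ c.natAbs := fun h x hx => by
    obtain ⟨y, hy, rfl⟩ := List.mem_map.1 hx
    rw [hck, Int.natAbs_neg]
    exact h y hy
  have hexp : expandAbs c (shrinkAbs c (-(k - 1))) = -(k - 1) :=
    expandAbs_shrinkAbs hc (by omega)
  refine Set.InvOn.bijOn (f' := fun u => k :: (u.map (expandAbs c)).map Neg.neg) ⟨?_, ?_⟩ ?_ ?_
  · rintro w ⟨hw, -⟩
    obtain ⟨j, u, rfl, -, hne⟩ := snakesB_eq_cons (by omega) hw
    show k :: ((((j :: u).map Neg.neg).map (shrinkAbs c)).map (expandAbs c)).map Neg.neg = _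
    rw [list_map_map_eq_self fun x hx => expandAbs_shrinkAbs hc (hnegne hne x hx),
      list_map_map_eq_self fun x _ => neg_neg x]
  · intro u _
    show (((u.map (expandAbs c)).map Neg.neg).map Neg.neg).map (shrinkAbs c) = u
    rw [list_map_map_eq_self fun x _ => neg_neg x,
      list_map_map_eq_self fun x _ => shrinkAbs_expandAbs x]
  · rintro w ⟨hw, hw1⟩
    obtain ⟨j, u, rfl, -, hne⟩ := snakesB_eq_cons (by omega) hw
    obtain rfl : j = k - 1 := by simpa using hw1
    obtain ⟨h1, h2, h3⟩ := isSignedPerm_iff.1 hw.1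
    refine ⟨isSignedPerm_iff.2 ⟨?_, by simpa using h2, ?_⟩,
      (isDownUp_cons_cons.1 hw.2.1).2.map fun x hx y hy =>
        shrinkAbs_lt hc (hnegne hne x hx) (hnegne hne y hy), rfl⟩
    · rw [List.map_cons, List.nodup_cons] at h1
      have h1' := h1.2
      simp only [List.drop_one, List.tail_cons]
      simp only [List.Nodup, List.pairwise_map] at h1' ⊢
      refine h1'.imp_of_mem fun {x y} hx hy hxy h => ?_
      have := hne x hx
      have := hne y hy
      simp only [shrinkAbs] at h
      split_ifs at h <;> omega
    · intro y hy
      simp only [List.drop_one, List.tail_cons, List.mem_map] at hy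
      obtain ⟨_, ⟨x, hx, rfl⟩, rfl⟩ := hy
      have := hne x hx
      have := h3 x (.tail _ hx)
      simp only [shrinkAbs]
      split_ifs <;> omega
  · intro u hu
    obtain ⟨h1, h2, h3⟩ := isSignedPerm_iff.1 hu.1
    have hmem : ∀ y ∈ (u.map (expandAbs c)).map Neg.neg, ∃ x ∈ u, y = -expandAbs c x := by
      intro y hy
      simp only [List.mem_map] at hy
      obtain ⟨_, ⟨x, hx, rfl⟩, rfl⟩ := hy
      exact ⟨x, hx, rfl⟩
    match u, h2, hu, h1, h3, hmem with
    | [], h2, _, _, _, _ => simp at h2; omega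
    | a :: u, h2, hu, h1, h3, hmem =>
      obtain rfl : a = shrinkAbs c (-(k - 1)) := by simpa using hu.2.2
      refine ⟨⟨isSignedPerm_iff.2 ⟨?_, by simpa using h2, ?_⟩, ?_, rfl⟩, ?_⟩
      · rw [List.map_cons, List.nodup_cons]
        constructor
        · rw [List.mem_map]
          rintro ⟨y, hy, hyk⟩
          obtain ⟨x, hx, rfl⟩ := hmem y hy
          simp only [expandAbs] at hyk
          split_ifs at hyk <;> omega
        · simp only [List.Nodup, List.pairwise_map] at h1 ⊢
          refine h1.imp fun {x y} hxy h => ?_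
          simp only [expandAbs] at h
          split_ifs at h <;> omega
      · intro y hy
        rcases List.mem_cons.1 hy with rfl | hy
        · omega
        · obtain ⟨x, hx, rfl⟩ := hmem y hy
          have := h3 x hx
          simp only [expandAbs]
          split_ifs <;> omega
      · simp only [List.map_cons, hexp, neg_neg]
        refine isDownUp_cons_cons.2 ⟨by omega, ?_⟩
        rw [List.map_cons, list_map_map_eq_self fun x _ => neg_neg x]
        have := hu.2.1.map (f := expandAbs c) fun x _ y _ => expandAbs_lt
        rwa [List.map_cons, hexp] at this
      · simpa using congrArg Neg.neg hexp

theorem encard_eq_of_bijOn {α β : Type*} {f : α → β} {s : Set α} {t : Set β}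
    (h : Set.BijOn f s t) : s.encard = t.encard := by
  rw [← h.image_eq, h.injOn.encard_image]

theorem encard_snakesB_succ {n : ℕ} {k c : ℤ} (hn : 1 ≤ n) (hc : 0 < c)
    (hck : c.natAbs = k.natAbs) (h1 : k ≠ 1) (hk : k.natAbs ≤ n + 1)
    (hk' : (k - 1).natAbs ≤ n + 1) :
    (snakesB (n + 1) k).encard =
      (snakesB (n + 1) (k - 1)).encard + (snakesB n (shrinkAbs c (-(k - 1)))).encard := by
  rw [← encard_eq_of_bijOn (bijOn_swapAbs (n := n + 1) (by omega) (by omega) h1 hk hk'),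
    ← encard_eq_of_bijOn (bijOn_shrinkAbs hn hc hck hk h1), ← Set.encard_union_eq]
  · congr 1
    ext w
    simp only [Set.mem_union, Set.mem_ofPred_eq]
    tauto
  · exact Set.disjoint_left.2 fun w hw hw' => hw.2 hw'.2

theorem encard_snakesB_one {k : ℤ} (hk : k.natAbs = 1) : (snakesB 1 k).encard = 1 := by
  rw [Set.encard_eq_one]
  refine ⟨[k], Set.eq_singleton_iff_unique_mem.2 ⟨⟨?_, trivial, rfl⟩, fun w hw => ?_⟩⟩
  · simp [isSignedPerm_iff, hk]
  · obtain ⟨a, rfl⟩ := List.length_eq_one_iff.1 hw.1.length_eq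
    simpa using hw.2.2

theorem snakesB_neg_eq_empty {n : ℕ} (hn : 2 ≤ n) : snakesB n (-(n : ℤ)) = ∅ := by
  refine Set.eq_empty_of_forall_notMem fun w hw => ?_
  obtain ⟨j, u, rfl, hj, -⟩ := snakesB_eq_cons hn hw
  have := (isSignedPerm_iff.1 hw.1).2.2 j (by simp)
  omega

theorem encard_snakesB (n : ℕ) (k : ℤ) (h1 : 1 ≤ k.natAbs) (hk : k.natAbs ≤ n) :
    (snakesB n k).encard = arnold n k := by
  induction n generalizing k with
  | zero => omega
  | succ n ihn =>
  -- Strong induction on the shifted k is needed because the step from 1 to -1 jumps over 0.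
  induction hm : (k + (n + 1)).toNat using Nat.strong_induction_on generalizing k with
  | _ m ihk =>
  have hrange : ¬ (k = 0 ∨ ((n + 1 : ℕ) : ℤ) < |k|) := by
    rw [Int.abs_eq_natAbs]; omega
  rw [arnold, if_neg hrange]
  by_cases hn : n + 1 = 1
  · obtain rfl : n = 0 := by omega
    rw [if_pos rfl, encard_snakesB_one (by omega)]
    rfl
  rw [if_neg hn]
  by_cases hkn : k = -((n + 1 : ℕ) : ℤ)
  · rw [if_pos hkn, hkn, snakesB_neg_eq_empty (by omega)]
    simp
  rw [if_neg hkn, Nat.add_sub_cancel]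
  split_ifs with hneg hone
  · rw [encard_snakesB_succ (c := -k) (by omega) (by omega) (by omega) (by omega) hk (by omega),
      ihk _ (by omega) (k - 1) (by omega) (by omega) rfl,
      show shrinkAbs (-k) (-(k - 1)) = -k by simp only [shrinkAbs]; split_ifs <;> omega,
      ihn (-k) (by omega) (by omega)]
    push_cast; rfl
  · subst hone
    rw [encard_eq_of_bijOn (bijOn_flipOne (by omega)),
      ihk _ (by omega) (-1) (by omega) (by omega) rfl]
  · rw [encard_snakesB_succ (c := k) (by omega) (by omega) (by omega) (by omega) hk (by omega),
      ihk _ (by omega) (k - 1) (by omega) (by omega) rfl,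
      show shrinkAbs k (-(k - 1)) = -k + 1 by simp only [shrinkAbs]; split_ifs <;> omega,
      ihn (-k + 1) (by omega) (by omega)]
    push_cast; rfl

end Counting

end ArnoldFamily

theorem theorem2p6 :
    (∀ (n : ℕ) (k : ℤ), 1 ≤ |k| → |k| ≤ (n : ℤ) →
      Set.BijOn psiB (snakesB n k) (treesB n k) ∧
      Set.BijOn omegaB (treesB n k) (andreB n k) ∧
      (arnold n k : ℕ∞) = (andreB n k).encard ∧
      (andreB n k).encard = (treesB n k).encard) ∧
    IsArnoldFamily andreB ∧ IsArnoldFamily treesB := by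
  have trees : IsArnoldFamily treesB := fun n k h1 h2 => by
    rw [Int.abs_eq_natAbs] at h1 h2
    rw [← encard_eq_of_bijOn (psiB_bijOn n k), encard_snakesB n k (by omega) (by omega)]
  have same : ∀ n k, (andreB n k).encard = (treesB n k).encard := fun n k =>
    (encard_eq_of_bijOn (omegaB_bijOn n k)).symm
  have andre : IsArnoldFamily andreB := fun n k h1 h2 => (same n k).trans (trees n k h1 h2)
  exact ⟨fun n k h1 h2 => ⟨psiB_bijOn n k, omegaB_bijOn n k, (andre n k h1 h2).symm, same n k⟩,
    andre, trees⟩
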